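/- **Setting.** Let $d\ge 3$, let $M$ be a connected smooth $d$-manifold, and let $c$ be a Riemannian conformal structure on $M$, i.e. an equivalence class of Riemannian metrics under $g\sim e^{2\omega}g$, $\omega\in C^\infty(M)$. For $g\in c$ let $\nabla$ be its Levi-Civita connection and $P=\frac1{d-2}(\mathrm{Ric}-Jg)$, $J=\mathrm{tr}_gP$, its Schouten tensor. A (standard) tractor field $K$ is given, for each $g\in c$, by a smooth triple $(\sigma,\mu_a,\rho)$ (function, $1$-form, function) such that the triple for $e^{2\omega}g$ is, with $\Upsilon=d\omega$, $$\bigl(e^{\omega}\sigma,\ e^{\omega}(\mu_a+\sigma\Upsilon_a),\ e^{-\omega}(\rho-g^{ab}\Upsilon_a\mu_b-\tfrac12\sigma g^{ab}\Upsilon_a\Upsilon_b)\bigr).$$ The tractor metric $h$ is the polarisation of $h(K,K)=2\rho\sigma+g^{ab}\mu_a\mu_b$, and $K$ is parallel if $\nabla_a\sigma-\mu_a=0$, $\nabla_a\mu_b+g_{ab}\rho+P_{ab}\sigma=0$ and $\nabla_a\rho-P_{ac}\mu^c=0$; the function $h(K,L)$ and these notions do not depend on $g\in c$. Put $S_K=-h(K,K)$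 and $\Sigma_K=\{\sigma=0\}$; on $M\setminus\Sigma_K$ the metric $\sigma^{-2}g$ and, for a second tractor $L$ with triples $(\tau,\nu_a,\theta)$, the function $\tau/\sigma$ do not depend on $g\in c$. For a hypersurface with unit normal $n$, the second fundamental form is $L(X,Y)=\langle\nabla_Xn,Y\rangle$ and the mean curvature is $H=\frac1{d-1}\mathrm{tr}\,L$. **Theorem 1.3.** Let $K_1,K_2$ be linearly independent parallel tractors on $(M,c)$, with first components $\sigma_1,\sigma_2$, such that $S_{K_2}<0$ and $\Sigma_{K_2}\neq\emptyset$. Then $h(K_1,K_2)$, $S_{K_1}$ and $S_{K_2}$ are constant, $M\setminus\Sigma_{K_1}$ is open, and $\bar g=\sigma_1^{-2}g$ is an Einstein metric on it, with $\mathrm{Ric}(\bar g)=(d-1)S_{K_1}\bar g$. The set $\Sigma_{K_2}$ is a smooth hypersurface of $M$, and $\Sigma_{K_2}\setminus\Sigma_{K_1}$ is totally umbilic and has constant mean curvature with respect to $\bar g$: it has a smooth unit normal in the direction of increasing $\sigma_2/\sigma_1$, and with respect to this normal $$H=-\frac{h(K_1,K_2)}{\sqrt{-S_{K_2}}},$$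 so that $H=-h(K_1,K_2)$ if $K_2$ is normalised to $S_{K_2}=-1$. If $h(K_1,K_2)=0$, then $\Sigma_{K_2}\setminus\Sigma_{K_1}$ is minimal, and hence totally geodesic, with respect to $\bar g$. -/

import Mathlib

set_option maxSynthPendingDepth 3

open Bundle Set
open scoped Manifold ContDiff Topology

noncomputable section

namespace ConfGeom

/-! ### Metrics and conformal structures -/

section Basic

/-- The model space `ℝ^d`. -/
abbrev Coord (d : ℕ) : Type := EuclideanSpace ℝ (Fin d)

/-- Smooth Riemannian metrics on `M`. -/
abbrev RMetric (d : ℕ) (M : Type*) [TopologicalSpace M] [ChartedSpace (Coord d) M]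
    [IsManifold (𝓡 d) ∞ M] : Type _ :=
  ContMDiffRiemannianMetric (𝓡 d) ∞ (Coord d) (fun p : M => TangentSpace (𝓡 d) p)

/-- Not necessarily smooth fields of bilinear forms on the tangent spaces. Metrics that are only
defined on an open set `U` are such fields, and only their values on `U` are used. -/
abbrev BilinField (d : ℕ) (M : Type*) [TopologicalSpace M] [ChartedSpace (Coord d) M]
    [IsManifold (𝓡 d) ∞ M] : Type _ :=
  ∀ p : M, TangentSpace (𝓡 d) p →L[ℝ] TangentSpace (𝓡 d) p →L[ℝ] ℝ

variable {d : ℕ} {M : Type*} [TopologicalSpace M] [ChartedSpace (Coord d) M]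
  [IsManifold (𝓡 d) ∞ M]

/-- `g' = e^{2ψ} g` -/
def IsRescaling (g g' : RMetric d M) (ψ : M → ℝ) : Prop :=
  ∀ p, g'.inner p = Real.exp (2 * ψ p) • g.inner p

/-- Two metrics are conformally related if `g' = e^{2ψ} g` with `ψ` smooth. -/
def ConformallyRelated (g g' : RMetric d M) : Prop :=
  ∃ ψ : M → ℝ, ContMDiff (𝓡 d) 𝓘(ℝ, ℝ) ∞ ψ ∧ IsRescaling g g' ψ

variable (d M) in
/-- Conformal relatedness is an equivalence relation. -/
def conformalSetoid : Setoid (RMetric d M) where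
  r := ConformallyRelated
  iseqv :=
    { refl := fun g => ⟨fun _ => 0, contMDiff_const, fun p => by simp⟩
      symm := by
        rintro g g' ⟨ψ, hψ, h⟩
        refine ⟨fun p => -ψ p, hψ.neg, fun p => ?_⟩
        rw [h p, smul_smul, ← Real.exp_add]
        simp
      trans := by
        rintro g g' g'' ⟨ψ, hψ, h⟩ ⟨ψ', hψ', h'⟩
        refine ⟨fun p => ψ' p + ψ p, hψ'.add hψ, fun p => ?_⟩
        rw [h' p, h p, smul_smul, ← Real.exp_add, mul_add] }

variable (d M) in
/-- A conformal structure `c` on `M`: an equivalence class of Riemannian metrics. -/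
def ConformalStructure : Type _ := Quotient (conformalSetoid d M)

/-- The metrics in the conformal class `c`. -/
def Scale (c : ConformalStructure d M) : Type _ :=
  {g : RMetric d M // Quotient.mk (conformalSetoid d M) g = c}

theorem Scale.related {c : ConformalStructure d M} (g g' : Scale c) :
    ConformallyRelated g.1 g'.1 :=
  Quotient.exact (g.2.trans g'.2.symm)

/-- Some metric of the class. The notions defined with it below do not depend on it. -/
def someScale (c : ConformalStructure d M) : Scale c :=
  ⟨Quotient.out c, Quotient.out_eq c⟩

/-- The Riesz isomorphism `α ↦ α^♯`, given by `G(α^♯, ·) = α`. -/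
def sharp (G : BilinField d M) (p : M) :
    (TangentSpace (𝓡 d) p →L[ℝ] ℝ) →L[ℝ] TangentSpace (𝓡 d) p :=
  (G p).inverse

/-- The pairing `G^{ab} α_a β_b` of two covectors. -/
def coInner (G : BilinField d M) (p : M) (α β : TangentSpace (𝓡 d) p →L[ℝ] ℝ) : ℝ :=
  α (sharp G p β)

theorem isInvertible_of_pos {E : Type*} [NormedAddCommGroup E] [NormedSpace ℝ E]
    [FiniteDimensional ℝ E] (B : E →L[ℝ] E →L[ℝ] ℝ) (hB : ∀ v, v ≠ 0 → 0 < B v v) :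
    B.IsInvertible := by
  have hinj : Function.Injective B := by
    refine (injective_iff_map_eq_zero _).2 fun v hv => ?_
    by_contra hne
    have h0 : B v v = 0 := by rw [hv]; rfl
    exact (hB v hne).ne' h0
  have hrank : Module.finrank ℝ E = Module.finrank ℝ (E →L[ℝ] ℝ) := by
    rw [(LinearMap.toContinuousLinearMap (𝕜 := ℝ) (E := E) (F' := ℝ)).finrank_eq.symm]
    exact (Subspace.dual_finrank_eq (K := ℝ) (V := E)).symm
  let e := LinearEquiv.ofInjectiveOfFinrankEq B.toLinearMap hinj hrank
  exact ⟨e.toContinuousLinearEquiv, by ext v w; rfl⟩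

theorem RMetric.isInvertible (g : RMetric d M) (p : M) : (g.inner p).IsInvertible :=
  isInvertible_of_pos (E := Coord d) (g.inner p) (g.pos p)

theorem RMetric.inner_sharp (g : RMetric d M) (p : M) (α : TangentSpace (𝓡 d) p →L[ℝ] ℝ)
    (v : TangentSpace (𝓡 d) p) : g.inner p (sharp g.inner p α) v = α v := by
  obtain ⟨e, he⟩ := g.isInvertible p
  unfold sharp
  rw [← he, ContinuousLinearMap.inverse_equiv]
  simp

theorem RMetric.sharp_inner (g : RMetric d M) (p : M) (v : TangentSpace (𝓡 d) p) :
    sharp g.inner p (g.inner p v) = v := by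
  obtain ⟨e, he⟩ := g.isInvertible p
  unfold sharp
  rw [← he, ContinuousLinearMap.inverse_equiv]
  simp

theorem RMetric.coInner_comm (g : RMetric d M) (p : M)
    (α β : TangentSpace (𝓡 d) p →L[ℝ] ℝ) :
    coInner g.inner p α β = coInner g.inner p β α := by
  unfold coInner
  rw [← g.inner_sharp p α, ← g.inner_sharp p β, g.symm]

theorem IsRescaling.sharp_eq {g g' : RMetric d M} {ψ : M → ℝ} (h : IsRescaling g g' ψ) (p : M)
    (α : TangentSpace (𝓡 d) p →L[ℝ] ℝ) :
    sharp g'.inner p α = (Real.exp (ψ p) ^ 2)⁻¹ • sharp g.inner p α := by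
  have h1 : g'.inner p ((Real.exp (ψ p) ^ 2)⁻¹ • sharp g.inner p α) = α := by
    ext v
    rw [h p, map_smul, two_mul, Real.exp_add]
    have := g.inner_sharp p α v
    simp only [smul_apply, smul_eq_mul, this]
    field_simp
  conv_lhs => rw [← h1]
  exact g'.sharp_inner p _

end Basic

/-! ### Levi-Civita connection and curvature, in coordinates

All tensors at `p` are computed in the coordinates `extChartAt (𝓡 d) p`; the tangent bundle
trivialization at `p` is the one given by these coordinates. -/

section Curvature

variable {d : ℕ} {M : Type*} [TopologicalSpace M] [ChartedSpace (Coord d) M]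
  [IsManifold (𝓡 d) ∞ M]

/-- The components, in the coordinates around `p`, of a tangent vector at `q`. -/
def comps (p q : M) : TangentSpace (𝓡 d) q →L[ℝ] Coord d :=
  (trivializationAt (Coord d) (TangentSpace (𝓡 d)) p).continuousLinearMapAt ℝ q

/-- The tangent vector at `q` with given components in the coordinates around `p`. -/
def ofComps (p q : M) : Coord d →L[ℝ] TangentSpace (𝓡 d) q :=
  (trivializationAt (Coord d) (TangentSpace (𝓡 d)) p).symmL ℝ q

theorem comps_eq_mfderiv {p q : M} (hq : q ∈ (chartAt (Coord d) p).source) :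
    comps (d := d) p q = mfderiv (𝓡 d) 𝓘(ℝ, Coord d) (extChartAt (𝓡 d) p) q :=
  TangentBundle.continuousLinearMapAt_trivializationAt hq

/-- The point with given coordinates. -/
abbrev pointAt (p : M) (y : Coord d) : M := (extChartAt (𝓡 d) p).symm y

/-- The coordinate expression `G_{ij}(y)` of a field of bilinear forms. -/
def metricInChart (G : BilinField d M) (p : M) (y : Coord d) : Coord d →L[ℝ] Coord d →L[ℝ] ℝ :=
  ContinuousLinearMap.bilinearComp (E := Coord d) (F := Coord d) (E' := Coord d) (F' := Coord d)
    (G (pointAt p y)) (ofComps p (pointAt p y)) (ofComps p (pointAt p y))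

theorem metricInChart_apply (G : BilinField d M) (p : M) (y u v : Coord d) :
    metricInChart G p y u v =
      G (pointAt p y) (ofComps p (pointAt p y) u) (ofComps p (pointAt p y) v) := rfl

/-- The coordinate expression of a `1`-form. -/
def formInChart (μ : ∀ q : M, TangentSpace (𝓡 d) q →L[ℝ] ℝ) (p : M) (y : Coord d) :
    Coord d →L[ℝ] ℝ :=
  (μ (pointAt p y)).comp (ofComps p (pointAt p y))

/-- The coordinate expression of a vector field. -/
def fieldInChart (N : ∀ q : M, TangentSpace (𝓡 d) q) (p : M) (y : Coord d) : Coord d :=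
  comps p (pointAt p y) (N (pointAt p y))

/-- `(u, v, w) ↦ (A(u, v, w) + A(v, u, w) - A(w, u, v)) / 2` -/
def koszul {E : Type*} [NormedAddCommGroup E] [NormedSpace ℝ E] (A : E →L[ℝ] E →L[ℝ] E →L[ℝ] ℝ) :
    E →L[ℝ] E →L[ℝ] E →L[ℝ] ℝ :=
  (2⁻¹ : ℝ) •
    (A + A.flip -
      (((ContinuousLinearMap.flipₗᵢ ℝ E E ℝ).toContinuousLinearEquiv :
        (E →L[ℝ] E →L[ℝ] ℝ) →L[ℝ] (E →L[ℝ] E →L[ℝ] ℝ)).comp A.flip))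

theorem koszul_apply {E : Type*} [NormedAddCommGroup E] [NormedSpace ℝ E]
    (A : E →L[ℝ] E →L[ℝ] E →L[ℝ] ℝ) (u v w : E) :
    koszul A u v w = 2⁻¹ * (A u v w + A v u w - A w u v) := by
  simp [koszul]

/-- Christoffel symbols of the first kind,
`Γ_{uvw} = (∂_u G(v, w) + ∂_v G(u, w) - ∂_w G(u, v)) / 2`. -/
def christoffelFirst (G : BilinField d M) (p : M) (y : Coord d) :
    Coord d →L[ℝ] Coord d →L[ℝ] Coord d →L[ℝ] ℝ :=
  koszul (fderiv ℝ (metricInChart G p) y)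

theorem christoffelFirst_apply (G : BilinField d M) (p : M) (y u v w : Coord d) :
    christoffelFirst G p y u v w =
      2⁻¹ * (fderiv ℝ (metricInChart G p) y u v w + fderiv ℝ (metricInChart G p) y v u w -
        fderiv ℝ (metricInChart G p) y w u v) :=
  koszul_apply _ u v w

/-- Christoffel symbols `Γ(u, v)`, given by `G(Γ(u, v), w) = Γ_{uvw}`. -/
def christoffel (G : BilinField d M) (p : M) (y : Coord d) : Coord d →L[ℝ] Coord d →L[ℝ] Coord d :=
  (ContinuousLinearMap.compL ℝ (Coord d) (Coord d →L[ℝ] ℝ) (Coord d)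
    (metricInChart G p y).inverse).comp (christoffelFirst G p y)

theorem christoffel_apply (G : BilinField d M) (p : M) (y u v : Coord d) :
    christoffel G p y u v = (metricInChart G p y).inverse (christoffelFirst G p y u v) := rfl

/-- The Levi-Civita covariant derivative of a vector field at `p`: `X ↦ ∇_X N`. -/
def covDeriv (G : BilinField d M) (N : ∀ q : M, TangentSpace (𝓡 d) q) (p : M) :
    TangentSpace (𝓡 d) p →L[ℝ] TangentSpace (𝓡 d) p :=
  (ofComps p p).comp
    ((fderiv ℝ (fieldInChart N p) (extChartAt (𝓡 d) p p) +
      (christoffel G p (extChartAt (𝓡 d) p p)).flip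
        (fieldInChart N p (extChartAt (𝓡 d) p p))).comp (comps p p))

/-- The Levi-Civita covariant derivative of a `1`-form at `p`: `(X, Y) ↦ (∇_X μ)(Y)`. -/
def covDerivForm (G : BilinField d M) (μ : ∀ q : M, TangentSpace (𝓡 d) q →L[ℝ] ℝ) (p : M)
    (X Y : TangentSpace (𝓡 d) p) : ℝ :=
  fderiv ℝ (formInChart μ p) (extChartAt (𝓡 d) p p) (comps p p X) (comps p p Y) -
    formInChart μ p (extChartAt (𝓡 d) p p)
      (christoffel G p (extChartAt (𝓡 d) p p) (comps p p X) (comps p p Y))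

/-- The curvature `R(u, v) w = ∇_u ∇_v w - ∇_v ∇_u w` of coordinate (constant component) fields. -/
def curvatureInChart (G : BilinField d M) (p : M) (y u v w : Coord d) : Coord d :=
  fderiv ℝ (christoffel G p) y u v w - fderiv ℝ (christoffel G p) y v u w +
    christoffel G p y u (christoffel G p y v w) - christoffel G p y v (christoffel G p y u w)

/-- The Ricci tensor in coordinates: the trace of `w ↦ R(w, u) v`. -/
def ricciInChart (G : BilinField d M) (p : M) (y u v : Coord d) : ℝ :=
  ∑ i, curvatureInChart G p y (EuclideanSpace.single i 1) u v i

/-- The Ricci tensor at `p`. -/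
def ricci (G : BilinField d M) (p : M) (X Y : TangentSpace (𝓡 d) p) : ℝ :=
  ricciInChart G p (extChartAt (𝓡 d) p p) (comps p p X) (comps p p Y)

/-- The scalar curvature `G^{ij} Ric_{ij}` at `p`. -/
def scalarCurv (G : BilinField d M) (p : M) : ℝ :=
  ∑ i, ∑ j, (metricInChart G p (extChartAt (𝓡 d) p p)).inverse (EuclideanSpace.proj i) j *
    ricciInChart G p (extChartAt (𝓡 d) p p) (EuclideanSpace.single i 1) (EuclideanSpace.single j 1)

/-- The Schouten tensor `P = (Ric - J G) / (d - 2)` with `J = tr P = Sc / (2 (d - 1))`, for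
`d ≥ 3`. -/
def schouten (G : BilinField d M) (p : M) (X Y : TangentSpace (𝓡 d) p) : ℝ :=
  (ricci G p X Y - scalarCurv G p / (2 * ((d : ℝ) - 1)) * G p X Y) / ((d : ℝ) - 2)

/-- `G` is a smooth Riemannian metric on the open set `U`. -/
structure IsMetricOn (G : BilinField d M) (U : Set M) : Prop where
  symm : ∀ p ∈ U, ∀ X Y : TangentSpace (𝓡 d) p, G p X Y = G p Y X
  pos : ∀ p ∈ U, ∀ X : TangentSpace (𝓡 d) p, X ≠ 0 → 0 < G p X X
  smooth : ContMDiffOn (𝓡 d) ((𝓡 d).prod 𝓘(ℝ, Coord d →L[ℝ] Coord d →L[ℝ] ℝ)) ∞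
    (fun p => TotalSpace.mk' (Coord d →L[ℝ] Coord d →L[ℝ] ℝ) p (G p)) U

end Curvature

/-! ### The standard tractor bundle -/

section Tractors

variable {d : ℕ} {M : Type*} [TopologicalSpace M] [ChartedSpace (Coord d) M]
  [IsManifold (𝓡 d) ∞ M]

variable (d) in
/-- Triples `(σ, μ_a, ρ)` at `p`; a metric `g ∈ c` identifies the fibre of the tractor bundle at
`p` with the space of these triples (the density bundles being trivialised by `g` as well). -/
abbrev Triple (p : M) : Type := ℝ × (TangentSpace (𝓡 d) p →L[ℝ] ℝ) × ℝ

/-- The change of triples under `g ↦ e^{2ψ} g`: the factors `e^{ψ}`, `e^{ψ}`, `e^{-ψ}` come from the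
conformal weights `1`, `1`, `-1` of `σ`, `μ_a` and `ρ`. -/
def transformTriple (g : RMetric d M) (ψ : M → ℝ) (p : M) (t : Triple d p) : Triple d p :=
  (Real.exp (ψ p) * t.1,
    Real.exp (ψ p) • (t.2.1 + t.1 • mvfderiv (𝓡 d) ψ p),
    (Real.exp (ψ p))⁻¹ * (t.2.2 - coInner g.inner p (mvfderiv (𝓡 d) ψ p) t.2.1 -
      2⁻¹ * t.1 * coInner g.inner p (mvfderiv (𝓡 d) ψ p) (mvfderiv (𝓡 d) ψ p)))

/-- The triple of smooth sections of the summands in `[T]_g = E[1] ⊕ E_a[1] ⊕ E[-1]`. -/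
structure IsSmoothTriple (t : ∀ p : M, Triple d p) : Prop where
  fst : ContMDiff (𝓡 d) 𝓘(ℝ, ℝ) ∞ (fun p => (t p).1)
  mid : ContMDiff (𝓡 d) ((𝓡 d).prod 𝓘(ℝ, Coord d →L[ℝ] ℝ)) ∞
    (fun p => TotalSpace.mk' (Coord d →L[ℝ] ℝ) (E := fun q : M => TangentSpace (𝓡 d) q →L[ℝ] ℝ)
      p (t p).2.1)
  last : ContMDiff (𝓡 d) 𝓘(ℝ, ℝ) ∞ (fun p => (t p).2.2)

/-- The vector space of smooth sections of the standard tractor bundle of `(M, c)`: a section is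
given by smooth triples, one for each metric in `c`, that are related by the transformation
formula. -/
def tractorSections (c : ConformalStructure d M) : Submodule ℝ (Scale c → ∀ p : M, Triple d p) where
  carrier := {K | (∀ g, IsSmoothTriple (K g)) ∧
    ∀ (g g' : Scale c) (ψ : M → ℝ), ContMDiff (𝓡 d) 𝓘(ℝ, ℝ) ∞ ψ → IsRescaling g.1 g'.1 ψ →
      ∀ p, K g' p = transformTriple g.1 ψ p (K g p)}
  zero_mem' := by
    refine ⟨fun g => ⟨contMDiff_const, ?_, contMDiff_const⟩, ?_⟩
    · exact contMDiff_zeroSection ℝ (fun q : M => TangentSpace (𝓡 d) q →L[ℝ] ℝ)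
    · intro g g' ψ _ _ p
      simp [transformTriple, coInner]; rfl
  add_mem' := by
    rintro K L ⟨hK, hK'⟩ ⟨hL, hL'⟩
    refine ⟨fun g => ⟨(hK g).fst.add (hL g).fst, (hK g).mid.add_section (hL g).mid,
      (hK g).last.add (hL g).last⟩, ?_⟩
    intro g g' ψ hψ h p
    simp only [Pi.add_apply, hK' g g' ψ hψ h p, hL' g g' ψ hψ h p]
    refine Prod.ext ?_ (Prod.ext ?_ ?_)
    · simp [transformTriple]; ring
    · simp only [transformTriple, Prod.snd_add, Prod.fst_add]; module
    · simp only [transformTriple, Prod.snd_add, Prod.fst_add, coInner, map_add]; ring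
  smul_mem' := by
    rintro a K ⟨hK, hK'⟩
    refine ⟨fun g => ⟨contMDiff_const.mul (hK g).fst, (hK g).mid.const_smul_section,
      contMDiff_const.mul (hK g).last⟩, ?_⟩
    intro g g' ψ hψ h p
    simp only [Pi.smul_apply, hK' g g' ψ hψ h p]
    refine Prod.ext ?_ (Prod.ext ?_ ?_)
    · simp [transformTriple]; ring
    · simp only [transformTriple, Prod.smul_snd, Prod.smul_fst, smul_eq_mul]; module
    · simp only [transformTriple, Prod.smul_snd, Prod.smul_fst, coInner, map_smul, smul_eq_mul]
      ring

/-- Smooth sections of the standard tractor bundle. -/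
abbrev Tractor (c : ConformalStructure d M) : Type _ := ↥(tractorSections c)

namespace Tractor

variable {c : ConformalStructure d M}

/-- `σ = h(X, K)`, an `E[1]`-density, as a function in the scale `g`. -/
def sigma (K : Tractor c) (g : Scale c) (p : M) : ℝ := (K.1 g p).1

/-- The component `μ_a` in the scale `g`. -/
def mu (K : Tractor c) (g : Scale c) (p : M) : TangentSpace (𝓡 d) p →L[ℝ] ℝ := (K.1 g p).2.1

/-- The component `ρ` in the scale `g`. -/
def rho (K : Tractor c) (g : Scale c) (p : M) : ℝ := (K.1 g p).2.2

/-- The tractor connection: `∇_X K` in the scale `g`, that is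
`(∇_a σ - μ_a, ∇_a μ_b + g_{ab} ρ + P_{ab} σ, ∇_a ρ - P_{ac} μ^c)` contracted with `X^a`. -/
def connection (K : Tractor c) (g : Scale c) (p : M) (X : TangentSpace (𝓡 d) p) :
    ℝ × (TangentSpace (𝓡 d) p → ℝ) × ℝ :=
  (mvfderiv (𝓡 d) (K.sigma g) p X - K.mu g p X,
    fun Y => covDerivForm g.1.inner (K.mu g) p X Y + g.1.inner p X Y * K.rho g p +
      schouten g.1.inner p X Y * K.sigma g p,
    mvfderiv (𝓡 d) (K.rho g) p X - schouten g.1.inner p X (sharp g.1.inner p (K.mu g p)))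

/-- `K` is parallel for the tractor connection. -/
def IsParallel (K : Tractor c) : Prop :=
  ∀ (g : Scale c) (p : M) (X : TangentSpace (𝓡 d) p), K.connection g p X = 0

/-- The tractor metric in the scale `g`, the polarisation of `2 ρ σ + μ^a μ_a`. -/
def innerIn (g : Scale c) (K L : Tractor c) (p : M) : ℝ :=
  K.sigma g p * L.rho g p + K.rho g p * L.sigma g p + coInner g.1.inner p (K.mu g p) (L.mu g p)

/-- The tractor metric `h(K, L)`, a function on `M`. -/
def inner (K L : Tractor c) (p : M) : ℝ := innerIn (someScale c) K L p

/-- The scale singularity set `Σ_K`, the zero set of `σ`. -/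
def singSet (K : Tractor c) : Set M := {p | K.sigma (someScale c) p = 0}

/-- `S_K = -h(K, K)`. -/
def S (K : Tractor c) (p : M) : ℝ := -inner K K p

/-- The metric `σ^{-2} g` determined by `K` on the complement of `Σ_K`. -/
def scaleMetric (K : Tractor c) : BilinField d M :=
  fun p => (K.sigma (someScale c) p ^ 2)⁻¹ • (someScale c).1.inner p

/-- The function `σ_L / σ_K` on the complement of `Σ_K`. -/
def ratio (L K : Tractor c) (p : M) : ℝ := L.sigma (someScale c) p / K.sigma (someScale c) p

theorem sigma_rescale (K : Tractor c) {g g' : Scale c} {ψ : M → ℝ}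
    (hψ : ContMDiff (𝓡 d) 𝓘(ℝ, ℝ) ∞ ψ) (h : IsRescaling g.1 g'.1 ψ) (p : M) :
    K.sigma g' p = Real.exp (ψ p) * K.sigma g p :=
  congrArg Prod.fst (K.2.2 g g' ψ hψ h p)

theorem inner_eq (K L : Tractor c) (g : Scale c) (p : M) : inner K L p = innerIn g K L p := by
  obtain ⟨ψ, hψ, h⟩ := Scale.related g (someScale c)
  have hK := K.2.2 g _ ψ hψ h p
  have hL := L.2.2 g _ ψ hψ h p
  have hs := h.sharp_eq p
  have c1 := g.1.coInner_comm p (K.1 g p).2.1 (mvfderiv (𝓡 d) ψ p)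
  simp only [inner, innerIn, sigma, mu, rho, hK, hL, transformTriple, coInner, hs, map_add,
    map_smul, smul_apply, add_apply, smul_eq_mul] at c1 ⊢
  rw [c1]
  field_simp
  ring

theorem mem_singSet (K : Tractor c) (g : Scale c) (p : M) :
    p ∈ K.singSet ↔ K.sigma g p = 0 := by
  obtain ⟨ψ, hψ, h⟩ := Scale.related g (someScale c)
  simp [singSet, K.sigma_rescale hψ h p, (Real.exp_pos _).ne']

theorem scaleMetric_eq (K : Tractor c) (g : Scale c) (p : M) :
    K.scaleMetric p = (K.sigma g p ^ 2)⁻¹ • g.1.inner p := by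
  obtain ⟨ψ, hψ, h⟩ := Scale.related g (someScale c)
  rw [scaleMetric, K.sigma_rescale hψ h p, h p, smul_smul, two_mul, Real.exp_add]
  congr 1
  field_simp

theorem ratio_eq (L K : Tractor c) (g : Scale c) (p : M) :
    ratio L K p = L.sigma g p / K.sigma g p := by
  obtain ⟨ψ, hψ, h⟩ := Scale.related g (someScale c)
  rw [ratio, K.sigma_rescale hψ h p, L.sigma_rescale hψ h p]
  field_simp

end Tractor

end Tractors

/-! ### Hypersurfaces -/

section Hypersurfaces

variable {d : ℕ} {M : Type*} [TopologicalSpace M] [ChartedSpace (Coord d) M]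
  [IsManifold (𝓡 d) ∞ M]

variable (d) in
/-- `A` is a smooth (embedded) hypersurface: near each of its points it is the zero set of a smooth
function with nowhere vanishing differential. -/
def IsHypersurface (A : Set M) : Prop :=
  ∀ p ∈ A, ∃ (U : Set M) (f : M → ℝ), IsOpen U ∧ p ∈ U ∧ ContMDiffOn (𝓡 d) 𝓘(ℝ, ℝ) ∞ f U ∧
    (∀ q ∈ U, mvfderiv (𝓡 d) f q ≠ 0) ∧ A ∩ U = {q ∈ U | f q = 0}

variable (d) in
/-- The tangent space at `p` of a hypersurface `A`: the tangent vectors of `M` that annihilate all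
functions that are smooth near `p` and vanish on `A`. -/
def tangentTo (A : Set M) (p : M) : Submodule ℝ (TangentSpace (𝓡 d) p) where
  carrier := {X | ∀ (U : Set M) (f : M → ℝ), IsOpen U → p ∈ U →
    ContMDiffOn (𝓡 d) 𝓘(ℝ, ℝ) ∞ f U → (∀ q ∈ A ∩ U, f q = 0) → mvfderiv (𝓡 d) f p X = 0}
  zero_mem' := fun U f _ _ _ _ => map_zero _
  add_mem' := fun hX hY U f hU hp hf h0 => by
    rw [map_add, hX U f hU hp hf h0, hY U f hU hp hf h0, add_zero]
  smul_mem' := fun a X hX U f hU hp hf h0 => by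
    rw [map_smul, hX U f hU hp hf h0, smul_zero]

/-- `N` is (a local extension of) a smooth unit normal field of `A` on the open set `U`: it is a
smooth vector field on `U` whose restriction to `A ∩ U` is a unit normal field. -/
structure IsUnitNormal (G : BilinField d M) (A U : Set M) (N : ∀ q : M, TangentSpace (𝓡 d) q) :
    Prop where
  isOpen : IsOpen U
  smooth : ContMDiffOn (𝓡 d) ((𝓡 d).prod 𝓘(ℝ, Coord d)) ∞
    (fun q => TotalSpace.mk' (Coord d) (E := fun q : M => TangentSpace (𝓡 d) q) q (N q)) U
  unit : ∀ q ∈ A ∩ U, G q (N q) (N q) = 1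
  normal : ∀ q ∈ A ∩ U, ∀ X ∈ tangentTo d A q, G q (N q) X = 0

/-- The second fundamental form `L(X, Y) = G(∇_X N, Y)`, for `X`, `Y` tangent to `A`. -/
def secondForm (G : BilinField d M) (N : ∀ q : M, TangentSpace (𝓡 d) q) (p : M)
    (X Y : TangentSpace (𝓡 d) p) : ℝ :=
  G p (covDeriv G N p X) Y

/-- The orthogonal projection `X ↦ X - G(N, X) N` of `T_p M` onto the tangent space of the
hypersurface with unit normal `N`. -/
def normalProj (G : BilinField d M) (N : ∀ q : M, TangentSpace (𝓡 d) q) (p : M) :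
    TangentSpace (𝓡 d) p →L[ℝ] TangentSpace (𝓡 d) p :=
  ContinuousLinearMap.id ℝ _ - (G p (N p)).smulRight (N p)

/-- The mean curvature `H = tr L / (d - 1)` with respect to the unit normal `N`. The trace of the
Weingarten map `X ↦ ∇_X N` of the tangent space of the hypersurface is computed on `T_p M`, after
composition with the orthogonal projection. -/
def meanCurvature (G : BilinField d M) (N : ∀ q : M, TangentSpace (𝓡 d) q) (p : M) : ℝ :=
  LinearMap.trace ℝ (TangentSpace (𝓡 d) p)
    ((covDeriv G N p).comp (normalProj G N p)).toLinearMap / ((d : ℝ) - 1)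

/-- `A` is totally umbilic in the open set `W`: the trace-free part of the second fundamental form
vanishes. -/
def IsTotallyUmbilic (G : BilinField d M) (A W : Set M) : Prop :=
  ∀ (U : Set M) (N : ∀ q : M, TangentSpace (𝓡 d) q), U ⊆ W → IsUnitNormal G A U N →
    ∀ p ∈ A ∩ U, ∀ X ∈ tangentTo d A p, ∀ Y ∈ tangentTo d A p,
      secondForm G N p X Y = meanCurvature G N p * G p X Y

/-- `A` is minimal in the open set `W`. -/
def IsMinimal (G : BilinField d M) (A W : Set M) : Prop :=
  ∀ (U : Set M) (N : ∀ q : M, TangentSpace (𝓡 d) q), U ⊆ W → IsUnitNormal G A U N →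
    ∀ p ∈ A ∩ U, meanCurvature G N p = 0

/-- `A` is totally geodesic in the open set `W`: its second fundamental form vanishes. -/
def IsTotallyGeodesic (G : BilinField d M) (A W : Set M) : Prop :=
  ∀ (U : Set M) (N : ∀ q : M, TangentSpace (𝓡 d) q), U ⊆ W → IsUnitNormal G A U N →
    ∀ p ∈ A ∩ U, ∀ X ∈ tangentTo d A p, ∀ Y ∈ tangentTo d A p, secondForm G N p X Y = 0

end Hypersurfaces

end ConfGeom

end

open ConfGeom

/-! Fix a metric `g` of the class. For a parallel tractor the first slot gives `μ = dσ`, the middle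
slot gives `Hess σ = -ρ g - σ P`, and the last gives `dρ = P(·, grad σ)`. In the differential of
`h(K, L)` the two Hessian terms coming from `⟨dσ_K, dσ_L⟩` therefore cancel against the derivatives
of `σ_K ρ_L + ρ_K σ_L`, and `h(K, L)` is constant on the connected manifold (`inner_const`).

Inserting this Hessian into the Ricci tensor of `σ⁻² g` (`ricci_conformal`) cancels every term with
`P`. What remains is `-(d - 1)(2ρσ + |dσ|²) σ⁻² g`, and the bracket is `h(K, K) = -S_K`.

On the zero set of `σ_L` the function `h(L, L)` reduces to `|dσ_L|²`. So `|dσ_L|²` is the positive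
constant `-S_L` there, and the zero set is regular. There also `Hess σ_L = -ρ_L g`, which is pure
trace. For `σ_K⁻² g` a unit normal `N` is dual to `a σ_K⁻¹ dσ_L` with `a = ±1 / √(-S_L)`, and the
conformal change of the connection gives `∇_X N = -a (σ_K ρ_L + ⟨dσ_K, dσ_L⟩) X` for tangent `X`
(`weingarten_conformal`). As `σ_L = 0`, the bracket is `h(K, L)`. The Weingarten map is thus a
multiple of the identity, which gives umbilicity and `H`; the sign of `a` is the side to which `N`
points.

The local computations are made in a chart, for bilinear forms on a vector space. The conditions on
`N` hold only on the zero set, so they may be differentiated only in tangent directions;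
`fderiv_apply_eq_zero_of_zero_set` does this. -/

namespace ConfGeom

/-! ### Local Riemannian geometry on a vector space -/

section LocalGeometry

open Filter

variable {E : Type*} [NormedAddCommGroup E] [NormedSpace ℝ E]

/-- Christoffel symbols of a field of bilinear forms on a vector space. -/
noncomputable def localChristoffel (B : E → E →L[ℝ] E →L[ℝ] ℝ) (y : E) : E →L[ℝ] E →L[ℝ] E :=
  (ContinuousLinearMap.compL ℝ E (E →L[ℝ] ℝ) E (B y).inverse).comp (koszul (fderiv ℝ B y))

theorem localChristoffel_apply (B : E → E →L[ℝ] E →L[ℝ] ℝ) (y u v : E) :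
    localChristoffel B y u v = (B y).inverse (koszul (fderiv ℝ B y) u v) := rfl

/-- The curvature of a field of bilinear forms on a vector space. -/
noncomputable def localCurvature (B : E → E →L[ℝ] E →L[ℝ] ℝ) (y u v w : E) : E :=
  fderiv ℝ (localChristoffel B) y u v w - fderiv ℝ (localChristoffel B) y v u w +
    localChristoffel B y u (localChristoffel B y v w) -
    localChristoffel B y v (localChristoffel B y u w)

/-- The covariant Hessian of a function on a vector space. -/
noncomputable def localHessian (B : E → E →L[ℝ] E →L[ℝ] ℝ) (s : E → ℝ) (y : E) :
    E →L[ℝ] E →L[ℝ] ℝ :=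
  fderiv ℝ (fderiv ℝ s) y -
    (ContinuousLinearMap.compL ℝ E E ℝ (fderiv ℝ s y)).comp (localChristoffel B y)

theorem localHessian_apply (B : E → E →L[ℝ] E →L[ℝ] ℝ) (s : E → ℝ) (y u v : E) :
    localHessian B s y u v =
      fderiv ℝ (fderiv ℝ s) y u v - fderiv ℝ s y (localChristoffel B y u v) := rfl

/-- `B` is a `C^2` Riemannian metric near `y`. -/
structure IsLocalMetric (B : E → E →L[ℝ] E →L[ℝ] ℝ) (y : E) : Prop where
  contDiffAt : ContDiffAt ℝ 2 B y
  symm : ∀ᶠ z in 𝓝 y, ∀ u v, B z u v = B z v u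
  pos : ∀ᶠ z in 𝓝 y, ∀ v, v ≠ 0 → 0 < B z v v

theorem apply_inverse_apply_of_pos [FiniteDimensional ℝ E] {b : E →L[ℝ] E →L[ℝ] ℝ}
    (hb : ∀ v, v ≠ 0 → 0 < b v v) (α : E →L[ℝ] ℝ) : b (b.inverse α) = α := by
  obtain ⟨e, rfl⟩ := isInvertible_of_pos b hb
  simp

theorem eq_of_forall_apply_eq_of_pos {b : E →L[ℝ] E →L[ℝ] ℝ}
    (hb : ∀ v, v ≠ 0 → 0 < b v v) {u v : E} (h : ∀ w, b u w = b v w) : u = v := by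
  by_contra hne
  have := hb (u - v) (sub_ne_zero.2 hne)
  rw [map_sub b, sub_apply, h, sub_self] at this
  exact lt_irrefl _ this

theorem inverse_apply_apply_of_pos [FiniteDimensional ℝ E] {b : E →L[ℝ] E →L[ℝ] ℝ}
    (hb : ∀ v, v ≠ 0 → 0 < b v v) (v : E) : b.inverse (b v) = v := by
  obtain ⟨e, rfl⟩ := isInvertible_of_pos b hb
  simp

theorem contDiffAt_inverse_of_pos [FiniteDimensional ℝ E] {F : Type*} [NormedAddCommGroup F]
    [NormedSpace ℝ F] {n : WithTop ℕ∞} {B : F → E →L[ℝ] E →L[ℝ] ℝ} {y : F}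
    (hB : ContDiffAt ℝ n B y) (hb : ∀ v, v ≠ 0 → 0 < B y v v) :
    ContDiffAt ℝ n (fun z => (B z).inverse) y := by
  have : CompleteSpace E := FiniteDimensional.complete ℝ E
  obtain ⟨e, he⟩ := isInvertible_of_pos (B y) hb
  have h := contDiffAt_map_inverse (𝕜 := ℝ) (n := n) e
  rw [he] at h
  exact h.comp y hB

theorem hasFDerivAt_fun_inv {s : E → ℝ} {s' : E →L[ℝ] ℝ} {y : E} (hs : HasFDerivAt s s' y)
    (h0 : s y ≠ 0) : HasFDerivAt (fun z => (s z)⁻¹) (-(s y ^ 2)⁻¹ • s') y :=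
  (hasDerivAt_inv h0).comp_hasFDerivAt y hs

namespace IsLocalMetric

variable {B B' : E → E →L[ℝ] E →L[ℝ] ℝ} {y : E} {s : E → ℝ}

/-- Pointwise identities such as `christoffel_conformal` are to be differentiated, so they are
needed at all points near `y`. -/
theorem eventually (h : IsLocalMetric B y) : ∀ᶠ z in 𝓝 y, IsLocalMetric B z := by
  filter_upwards [h.contDiffAt.eventually (by decide), h.symm.eventually_nhds,
    h.pos.eventually_nhds] with z h₁ h₂ h₃
  exact ⟨h₁, h₂, h₃⟩

theorem symm_self (h : IsLocalMetric B y) (u v : E) : B y u v = B y v u :=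
  h.symm.self_of_nhds u v

theorem pos_self (h : IsLocalMetric B y) : ∀ v, v ≠ 0 → 0 < B y v v :=
  h.pos.self_of_nhds

theorem differentiableAt (h : IsLocalMetric B y) : DifferentiableAt ℝ B y :=
  h.contDiffAt.differentiableAt (by decide)

theorem congr (h : IsLocalMetric B y) (hs : ContDiffAt ℝ 2 s y) (hs0 : s y ≠ 0)
    (hB' : B' =ᶠ[𝓝 y] fun z => (s z ^ 2)⁻¹ • B z) : IsLocalMetric B' y where
  contDiffAt := (((hs.pow 2).inv (by positivity)).smul h.contDiffAt).congr_of_eventuallyEq hB'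
  symm := by
    filter_upwards [hB', h.symm] with z hz h' u v
    simp [hz, h' u v]
  pos := by
    filter_upwards [hB', h.pos, hs.continuousAt.eventually_ne hs0] with z hz h' h0 v hv
    have := h' v hv
    simp only [hz, smul_apply, smul_eq_mul]
    positivity

theorem fderiv_symm (h : IsLocalMetric B y) (x u v : E) :
    fderiv ℝ B y x u v = fderiv ℝ B y x v u := by
  have e : (fun z => B z u v) =ᶠ[𝓝 y] fun z => B z v u := by
    filter_upwards [h.symm] with z hz using hz u v
  have key (a b : E) : HasFDerivAt (fun z => B z a b) ((fderiv ℝ B y).flip a |>.flip b) y :=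
    ((h.differentiableAt.hasFDerivAt.clm_apply (hasFDerivAt_const a y)).clm_apply
      (hasFDerivAt_const b y)).congr_fderiv (by ext; simp)
  simpa using DFunLike.congr_fun ((key u v).unique ((key v u).congr_of_eventuallyEq e)) x

variable [FiniteDimensional ℝ E]

theorem apply_christoffel (h : IsLocalMetric B y) (u v w : E) :
    B y (localChristoffel B y u v) w =
      2⁻¹ * (fderiv ℝ B y u v w + fderiv ℝ B y v u w - fderiv ℝ B y w u v) := by
  rw [localChristoffel_apply, apply_inverse_apply_of_pos h.pos_self, koszul_apply]

theorem christoffel_symm (h : IsLocalMetric B y) (u v : E) :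
    localChristoffel B y u v = localChristoffel B y v u := by
  refine eq_of_forall_apply_eq_of_pos h.pos_self fun w => ?_
  rw [h.apply_christoffel, h.apply_christoffel, h.fderiv_symm w u v]
  ring

/-- Metric compatibility of the Levi-Civita connection. -/
theorem fderiv_eq (h : IsLocalMetric B y) (x u v : E) :
    fderiv ℝ B y x u v =
      B y (localChristoffel B y x u) v + B y u (localChristoffel B y x v) := by
  rw [h.symm_self u, h.apply_christoffel, h.apply_christoffel, h.fderiv_symm u x v,
    h.fderiv_symm x v u, h.fderiv_symm v x u]
  ring

theorem contDiffAt_christoffel (h : IsLocalMetric B y) :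
    ContDiffAt ℝ 1 (localChristoffel B) y := by
  have h₁ := contDiffAt_inverse_of_pos (h.contDiffAt.of_le (m := 1) (by decide)) h.pos_self
  have h₂ : ContDiffAt ℝ 1 (fderiv ℝ B) y := h.contDiffAt.fderiv_right (by decide)
  have h₃ : ContDiffAt ℝ 1 (fun z => koszul (fderiv ℝ B z)) y := by
    -- `koszul` is linear on a finite-dimensional space, hence smooth. The cases `c = 1` and `A = 0`
    -- of this identity give additivity and homogeneity.
    have e : ∀ A B : E →L[ℝ] E →L[ℝ] E →L[ℝ] ℝ, ∀ c : ℝ,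
      koszul (A + c • B) = koszul A + c • koszul B := fun A B c => by
        ext u v w
        simp only [koszul_apply, add_apply, smul_apply, smul_eq_mul]
        ring
    let k : (E →L[ℝ] E →L[ℝ] E →L[ℝ] ℝ) →ₗ[ℝ] (E →L[ℝ] E →L[ℝ] E →L[ℝ] ℝ) :=
      { toFun := koszul
        map_add' := fun A B => by simpa using e A B 1
        map_smul' := fun c B => by
          have h0 : koszul (0 : E →L[ℝ] E →L[ℝ] E →L[ℝ] ℝ) = 0 := by
            ext u v w
            simp [koszul_apply]
          simpa [h0] using e 0 B c }
    exact (LinearMap.toContinuousLinearMap k).contDiff.contDiffAt.comp y h₂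
  exact ((ContinuousLinearMap.compL ℝ E (E →L[ℝ] ℝ) E).contDiff.contDiffAt.comp y h₁).clm_comp h₃

theorem hessian_symm (h : IsLocalMetric B y) (hs : ContDiffAt ℝ 2 s y) (u v : E) :
    localHessian B s y u v = localHessian B s y v u := by
  rw [localHessian_apply, localHessian_apply, h.christoffel_symm,
    (hs.isSymmSndFDerivAt (by simp)) u v]

/-- The change of the Christoffel symbols under `B ↦ s^{-2} B`. -/
theorem christoffel_conformal (h : IsLocalMetric B y) (hs : DifferentiableAt ℝ s y)
    (hs0 : s y ≠ 0) (hB' : B' =ᶠ[𝓝 y] fun z => (s z ^ 2)⁻¹ • B z) (u v : E) :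
    localChristoffel B' y u v = localChristoffel B y u v -
      (s y)⁻¹ • (fderiv ℝ s y u • v + fderiv ℝ s y v • u -
        B y u v • (B y).inverse (fderiv ℝ s y)) := by
  have e₀ : B' y = (s y ^ 2)⁻¹ • B y := hB'.self_of_nhds
  have hpos : ∀ v, v ≠ 0 → 0 < B' y v v := fun v hv => by
    have := h.pos_self v hv
    simp only [e₀, smul_apply, smul_eq_mul]
    positivity
  have e₁ : ∀ x, fderiv ℝ B' y x =
      (s y ^ 2)⁻¹ • fderiv ℝ B y x - (2 * fderiv ℝ s y x * (s y ^ 3)⁻¹) • B y := fun x => by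
    rw [hB'.fderiv_eq]
    have hd := (hasFDerivAt_fun_inv (s := fun z => s z ^ 2) (hs.hasFDerivAt.pow 2)
      (pow_ne_zero 2 hs0)).smul h.differentiableAt.hasFDerivAt
    have hd' : fderiv ℝ (fun z => (s z ^ 2)⁻¹ • B z) y = _ := hd.fderiv
    rw [hd']
    ext a b
    simp
    field_simp
    ring
  -- Pairing with `w` in `B'` removes the inverses and leaves the two Koszul formulas, related by
  -- the product rule `e₁`.
  refine eq_of_forall_apply_eq_of_pos hpos fun w => ?_
  rw [localChristoffel_apply, apply_inverse_apply_of_pos hpos, koszul_apply, e₀]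
  simp only [e₁, smul_apply, sub_apply, map_sub, map_add, map_smul, add_apply,
    apply_inverse_apply_of_pos h.pos_self, h.apply_christoffel, smul_eq_mul]
  rw [h.symm_self u w, h.symm_self v w]
  field_simp
  ring

/-- The derivative of the gradient of a function. -/
theorem hasFDerivAt_gradient (h : IsLocalMetric B y) (hs : ContDiffAt ℝ 2 s y) :
    HasFDerivAt (fun z => (B z).inverse (fderiv ℝ s z))
      ((B y).inverse ∘L localHessian B s y -
        (localChristoffel B y).flip ((B y).inverse (fderiv ℝ s y))) y := by
  have h₁ : ContDiffAt ℝ 1 (fderiv ℝ s) y := hs.fderiv_right (by decide)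
  have h₂ := contDiffAt_inverse_of_pos (h.contDiffAt.of_le (m := 1) (by decide)) h.pos_self
  have h₃ : DifferentiableAt ℝ (fun z => (B z).inverse (fderiv ℝ s z)) y :=
    (h₂.clm_apply h₁).differentiableAt (by decide)
  refine h₃.hasFDerivAt.congr_fderiv ?_
  -- Differentiating `B(grad s, ·) = ds` and using metric compatibility yields `B(∇_x grad s, ·) =
  -- Hess s(x, ·)`; the flipped Christoffel term is the difference between `∇` and the coordinate
  -- derivative.
  have e : (fun z => B z ((B z).inverse (fderiv ℝ s z))) =ᶠ[𝓝 y] fderiv ℝ s := by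
    filter_upwards [h.pos] with z hz using apply_inverse_apply_of_pos hz _
  have h₄ := (h.differentiableAt.hasFDerivAt.clm_apply h₃.hasFDerivAt).unique
    ((h₁.differentiableAt (by decide)).hasFDerivAt.congr_of_eventuallyEq e)
  ext x
  refine eq_of_forall_apply_eq_of_pos h.pos_self fun w => ?_
  have h₅ := DFunLike.congr_fun (DFunLike.congr_fun h₄ x) w
  simp only [add_apply, ContinuousLinearMap.comp_apply, ContinuousLinearMap.flip_apply,
    h.fderiv_eq] at h₅
  simp only [sub_apply, ContinuousLinearMap.comp_apply, ContinuousLinearMap.flip_apply, map_sub,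
    apply_inverse_apply_of_pos h.pos_self, localHessian_apply, ← h₅]
  ring

/-- The change of the curvature under `B ↦ s^{-2} B`. -/
theorem curvature_conformal (h : IsLocalMetric B y) (hs : ContDiffAt ℝ 2 s y)
    (hs0 : s y ≠ 0) (hB' : B' =ᶠ[𝓝 y] fun z => (s z ^ 2)⁻¹ • B z) (u v w : E) :
    localCurvature B' y u v w = localCurvature B y u v w +
      ((s y ^ 2)⁻¹ * fderiv ℝ s y ((B y).inverse (fderiv ℝ s y))) •
        (B y u w • v - B y v w • u) -
      (s y)⁻¹ • (localHessian B s y u w • v - localHessian B s y v w • u -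
        B y v w • (B y).inverse (localHessian B s y u) +
        B y u w • (B y).inverse (localHessian B s y v)) := by
  have h' := h.congr hs hs0 hB'
  have hs₁ := hs.differentiableAt (by decide : (2 : WithTop ℕ∞) ≠ 0)
  have hs₂ : DifferentiableAt ℝ (fderiv ℝ s) y :=
    (hs.fderiv_right (m := 1) (by decide)).differentiableAt (by decide)
  have hΓ := h.contDiffAt_christoffel.differentiableAt (by decide : (1 : WithTop ℕ∞) ≠ 0)
  have hΓ' := h'.contDiffAt_christoffel.differentiableAt (by decide : (1 : WithTop ℕ∞) ≠ 0)
  set g : E := (B y).inverse (fderiv ℝ s y) with hg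
  -- This is the derivative of `christoffel_conformal`, with `hasFDerivAt_gradient` for the gradient
  -- term.
  have key (x a b : E) : fderiv ℝ (localChristoffel B') y x a b =
      fderiv ℝ (localChristoffel B) y x a b +
      ((s y ^ 2)⁻¹ * fderiv ℝ s y x) •
        (fderiv ℝ s y a • b + fderiv ℝ s y b • a - B y a b • g) -
      (s y)⁻¹ • (fderiv ℝ (fderiv ℝ s) y x a • b + fderiv ℝ (fderiv ℝ s) y x b • a -
        fderiv ℝ B y x a b • g -
        B y a b • ((B y).inverse (localHessian B s y x) - localChristoffel B y x g)) := by
    have e : (fun z => localChristoffel B' z a b) =ᶠ[𝓝 y] fun z => localChristoffel B z a b -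
        (s z)⁻¹ • (fderiv ℝ s z a • b + fderiv ℝ s z b • a -
          B z a b • (B z).inverse (fderiv ℝ s z)) := by
      filter_upwards [h.eventually, hs.eventually (by decide), hs.continuousAt.eventually_ne hs0,
        hB'.eventually_nhds] with z h₁ h₂ h₃ h₄
      exact h₁.christoffel_conformal (h₂.differentiableAt (by decide)) h₃ h₄ a b
    have d₁ := (hΓ'.hasFDerivAt.clm_apply (hasFDerivAt_const a y)).clm_apply
      (hasFDerivAt_const b y)
    have d₂ := (hΓ.hasFDerivAt.clm_apply (hasFDerivAt_const a y)).clm_apply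
      (hasFDerivAt_const b y)
    have d₃ := (h.differentiableAt.hasFDerivAt.clm_apply (hasFDerivAt_const a y)).clm_apply
      (hasFDerivAt_const b y)
    have d₄ (a : E) := hs₂.hasFDerivAt.clm_apply (hasFDerivAt_const a y)
    have d₅ := (d₂.sub ((hasFDerivAt_fun_inv hs₁.hasFDerivAt hs0).smul ((((d₄ a).smul_const b).add
      ((d₄ b).smul_const a)).sub (d₃.smul (h.hasFDerivAt_gradient hs))))).congr_of_eventuallyEq e
    have d₆ := DFunLike.congr_fun (d₁.unique d₅) x
    simp only [add_apply, sub_apply, smul_apply, ContinuousLinearMap.comp_apply,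
      ContinuousLinearMap.flip_apply, ContinuousLinearMap.smulRight_apply, map_zero, zero_apply,
      zero_add, Pi.add_apply, Pi.sub_apply, Pi.smul_apply'] at d₆
    rw [d₆]
    simp only [← hg, smul_eq_mul]
    module
  -- Derivatives of `ds` and of `B` are traded for covariant expressions plus Christoffel terms; the
  -- latter cancel after antisymmetrisation in `u`, `v`.
  have hgrad' (x : E) : B y x g = fderiv ℝ s y x := by
    rw [h.symm_self, hg, apply_inverse_apply_of_pos h.pos_self]
  have hD (x a : E) : fderiv ℝ (fderiv ℝ s) y x a =
      localHessian B s y x a + fderiv ℝ s y (localChristoffel B y x a) := by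
    rw [localHessian_apply]; ring
  simp only [localCurvature, key, hD, h.fderiv_eq, h.christoffel_conformal hs₁ hs0 hB', map_sub,
    map_add, map_smul, ← hg, hgrad', smul_eq_mul]
  rw [h.christoffel_symm v u, h.symm_self v u, h.hessian_symm hs v u]
  module

end IsLocalMetric

end LocalGeometry

/-! ### Inner products of gradients, and the Weingarten map under a conformal change -/

section LocalGeometry

variable {E : Type*} [NormedAddCommGroup E] [NormedSpace ℝ E] [FiniteDimensional ℝ E]
  {B B' : E → E →L[ℝ] E →L[ℝ] ℝ} {y : E} {s t : E → ℝ}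

namespace IsLocalMetric

/-- Both sides are the `B`-product of the vectors dual to `α` and `β`. -/
theorem apply_inverse_comm (h : IsLocalMetric B y) (α β : E →L[ℝ] ℝ) :
    α ((B y).inverse β) = β ((B y).inverse α) := by
  rw [← apply_inverse_apply_of_pos h.pos_self α, ← apply_inverse_apply_of_pos h.pos_self β,
    inverse_apply_apply_of_pos h.pos_self, inverse_apply_apply_of_pos h.pos_self, h.symm_self]

/-- The derivative of the inner product of two gradients. -/
theorem hasFDerivAt_inner_gradient (h : IsLocalMetric B y) (hs : ContDiffAt ℝ 2 s y)
    (ht : ContDiffAt ℝ 2 t y) :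
    HasFDerivAt (fun z => fderiv ℝ s z ((B z).inverse (fderiv ℝ t z)))
      ((localHessian B s y).flip ((B y).inverse (fderiv ℝ t y)) +
        (localHessian B t y).flip ((B y).inverse (fderiv ℝ s y))) y := by
  have hs₂ : DifferentiableAt ℝ (fderiv ℝ s) y :=
    (hs.fderiv_right (m := 1) (by decide)).differentiableAt (by decide)
  refine (hs₂.hasFDerivAt.clm_apply (h.hasFDerivAt_gradient ht)).congr_fderiv ?_
  ext x
  simp only [add_apply, sub_apply, ContinuousLinearMap.comp_apply, ContinuousLinearMap.flip_apply,
    map_sub]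
  rw [h.apply_inverse_comm, localHessian_apply B s]
  ring

/-- The Weingarten map, for the metric `s^{-2} B`, of the zero set of a function `t` whose Hessian
with respect to `B` is pure trace in the direction `x`. The unit normal is `N`. -/
theorem weingarten_conformal (h : IsLocalMetric B y) (hs : ContDiffAt ℝ 2 s y) (hs0 : s y ≠ 0)
    (hB' : B' =ᶠ[𝓝 y] fun z => (s z ^ 2)⁻¹ • B z) {N : E → E} (hN : DifferentiableAt ℝ N y)
    {x : E} {a r : ℝ} (hx : fderiv ℝ t y x = 0)
    (hN₀ : B' y (N y) = (a * (s y)⁻¹) • fderiv ℝ t y)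
    (hN₁ : fderiv ℝ (fun z => B' z (N z)) y x =
      a • ((s y)⁻¹ • fderiv ℝ (fderiv ℝ t) y x - ((s y ^ 2)⁻¹ * fderiv ℝ s y x) • fderiv ℝ t y))
    (hr : localHessian B t y x = -r • B y x) :
    fderiv ℝ N y x + localChristoffel B' y x (N y) =
      -(a * (s y * r + fderiv ℝ s y ((B y).inverse (fderiv ℝ t y)))) • x := by
  have h' := h.congr hs hs0 hB'
  have e₀ : B' y = (s y ^ 2)⁻¹ • B y := hB'.self_of_nhds
  -- Lowering the index, `B'(∇'_x N, w)` is the covariant derivative of the form `a s⁻¹ dt`. In the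
  -- change of the Christoffel symbols the term with `dt(x)` vanishes, and the one with `ds(x)
  -- dt(w)` cancels the derivative of `s⁻¹`.
  refine eq_of_forall_apply_eq_of_pos h'.pos_self fun w => ?_
  have hd := (h'.differentiableAt.hasFDerivAt.clm_apply hN.hasFDerivAt).fderiv
  have h₁ := DFunLike.congr_fun hN₁ w
  rw [hd] at h₁
  simp only [add_apply, ContinuousLinearMap.comp_apply, ContinuousLinearMap.flip_apply,
    h'.fderiv_eq, hN₀] at h₁
  rw [h.christoffel_conformal (hs.differentiableAt (by decide)) hs0 hB' x w] at h₁
  simp only [smul_apply, sub_apply, smul_eq_mul, map_sub, map_add, map_smul, hx] at h₁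
  have h₂ := DFunLike.congr_fun hr w
  simp only [localHessian_apply, smul_apply, smul_eq_mul] at h₂
  rw [h.apply_inverse_comm (fderiv ℝ t y)] at h₁
  rw [eq_add_of_sub_eq h₂] at h₁
  simp only [map_add, add_apply, map_smul, smul_apply, smul_eq_mul]
  have h₃ : B' y x w = (s y ^ 2)⁻¹ * B y x w := by simp [e₀]
  have h₄ : s y * (s y ^ 2)⁻¹ = (s y)⁻¹ := by field_simp
  rw [h₃]
  linear_combination h₁ + (a * r * B y x w) * h₄

end IsLocalMetric

end LocalGeometry

/-! ### The Ricci tensor under a conformal change -/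

section LocalRicci

variable {d : ℕ} {B B' : Coord d → Coord d →L[ℝ] Coord d →L[ℝ] ℝ} {y : Coord d} {s : Coord d → ℝ}

/-- The Ricci tensor of a field of bilinear forms on `ℝ^d`. -/
noncomputable def localRicci (B : Coord d → Coord d →L[ℝ] Coord d →L[ℝ] ℝ) (y u v : Coord d) : ℝ :=
  ∑ i, localCurvature B y (EuclideanSpace.single i 1) u v i

/-- The trace of a bilinear form with respect to `B`. -/
noncomputable def localTrace (B : Coord d → Coord d →L[ℝ] Coord d →L[ℝ] ℝ) (y : Coord d)
    (T : Coord d → Coord d → ℝ) : ℝ :=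
  ∑ i, ∑ j, (B y).inverse (EuclideanSpace.proj i) j *
    T (EuclideanSpace.single i 1) (EuclideanSpace.single j 1)

theorem sum_apply_mul_single (α : Coord d →L[ℝ] ℝ) (v : Coord d) :
    ∑ i, v i * α (EuclideanSpace.single i 1) = α v := by
  conv_rhs => rw [← (EuclideanSpace.basisFun (Fin d) ℝ).sum_repr v, map_sum]
  simp

namespace IsLocalMetric

/-- Summing over `j` evaluates `T(e_i, ·)` on the vector dual to the `i`-th coordinate; symmetry of
the inverse metric turns this into a diagonal entry of `T` with one index raised. -/
theorem localTrace_eq (h : IsLocalMetric B y) (T : Coord d →L[ℝ] Coord d →L[ℝ] ℝ) :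
    localTrace B y (fun u v => T u v) =
      ∑ i, (B y).inverse (T (EuclideanSpace.single i 1)) i := by
  refine Finset.sum_congr rfl fun i _ => ?_
  rw [sum_apply_mul_single]
  exact h.apply_inverse_comm _ (EuclideanSpace.proj i : Coord d →L[ℝ] ℝ)

theorem localTrace_self (h : IsLocalMetric B y) : localTrace B y (fun u v => B y u v) = d := by
  rw [h.localTrace_eq]
  simp [inverse_apply_apply_of_pos h.pos_self]

/-- The change of the Ricci tensor under `B ↦ s^{-2} B`. -/
theorem ricci_conformal (h : IsLocalMetric B y) (hs : ContDiffAt ℝ 2 s y)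
    (hs0 : s y ≠ 0) (hB' : B' =ᶠ[𝓝 y] fun z => (s z ^ 2)⁻¹ • B z) (v w : Coord d) :
    localRicci B' y v w = localRicci B y v w -
      ((d : ℝ) - 1) * ((s y ^ 2)⁻¹ * fderiv ℝ s y ((B y).inverse (fderiv ℝ s y))) * B y v w +
      (s y)⁻¹ * (((d : ℝ) - 2) * localHessian B s y v w +
        B y v w * localTrace B y (fun u v => localHessian B s y u v)) := by
  rw [h.localTrace_eq]
  -- These sums contract the terms of `curvature_conformal` at `u = e_i` with the `i`-th coordinate.
  -- The Hessian occurs `d` times from `e₄` and is subtracted once each by `e₂` and `e₃`, whence `d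
  -- - 2`.
  have e₁ := sum_apply_mul_single ((B y).flip w) v
  have e₂ := sum_apply_mul_single ((localHessian B s y).flip w) v
  have e₃ := sum_apply_mul_single ((B y).flip w) ((B y).inverse (localHessian B s y v))
  simp only [ContinuousLinearMap.flip_apply, apply_inverse_apply_of_pos h.pos_self] at e₁ e₂ e₃
  have e₄ : ∀ c : ℝ, ∑ i : Fin d, c * (EuclideanSpace.single i (1 : ℝ) : Coord d) i = d * c := by
    intro c
    simp
  simp only [localRicci, h.curvature_conformal hs hs0 hB', PiLp.add_apply, PiLp.sub_apply,
    PiLp.smul_apply, smul_eq_mul, Finset.sum_add_distrib, Finset.sum_sub_distrib,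
    ← Finset.mul_sum, e₄]
  have e₁' : ∑ i, B y (EuclideanSpace.single i 1) w * v i = B y v w := by
    simpa only [mul_comm] using e₁
  have e₂' : ∑ i, localHessian B s y (EuclideanSpace.single i 1) w * v i =
      localHessian B s y v w := by
    simpa only [mul_comm] using e₂
  have e₃' : ∑ i, B y (EuclideanSpace.single i 1) w * (B y).inverse (localHessian B s y v) i =
      localHessian B s y v w := by
    simpa only [mul_comm] using e₃
  rw [e₁', e₂', e₃']
  ring

/-- If the trace-free part of `Hess s + s P` vanishes, then `s^{-2} B` is an Einstein metric. -/
theorem ricci_conformal_of_hessian (hd : 3 ≤ d) (h : IsLocalMetric B y) (hs : ContDiffAt ℝ 2 s y)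
    (hs0 : s y ≠ 0) (hB' : B' =ᶠ[𝓝 y] fun z => (s z ^ 2)⁻¹ • B z) {r : ℝ}
    (hr : ∀ u v, localHessian B s y u v + B y u v * r +
      (localRicci B y u v - localTrace B y (localRicci B y) / (2 * ((d : ℝ) - 1)) * B y u v) /
        ((d : ℝ) - 2) * s y = 0) (v w : Coord d) :
    localRicci B' y v w =
      -((d : ℝ) - 1) * (2 * r * s y + fderiv ℝ s y ((B y).inverse (fderiv ℝ s y))) *
        ((s y ^ 2)⁻¹ * B y v w) := by
  have hd' : (3 : ℝ) ≤ d := by exact_mod_cast hd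
  have h₂ : (d : ℝ) - 2 ≠ 0 := by linarith
  have h₁ : (d : ℝ) - 1 ≠ 0 := by linarith
  set J := localTrace B y (localRicci B y) / (2 * ((d : ℝ) - 1)) with hJ
  have hH : ∀ u v, localHessian B s y u v =
      (J * s y / ((d : ℝ) - 2) - r) * B y u v - s y / ((d : ℝ) - 2) * localRicci B y u v := by
    intro u v
    have := hr u v
    field_simp at this ⊢
    linarith
  -- With `Hess s = -r B - s P` this is `tr B = d` and `tr P = J`.
  have htr : localTrace B y (fun u v => localHessian B s y u v) = -(d * r) - s y * J := by
    have e : localTrace B y (fun u v => localHessian B s y u v) =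
        (J * s y / ((d : ℝ) - 2) - r) * localTrace B y (fun u v => B y u v) -
          s y / ((d : ℝ) - 2) * localTrace B y (localRicci B y) := by
      simp only [localTrace, Finset.mul_sum, ← Finset.sum_sub_distrib, hH]
      refine Finset.sum_congr rfl fun i _ => Finset.sum_congr rfl fun j _ => ?_
      ring
    have e' : localTrace B y (localRicci B y) = 2 * ((d : ℝ) - 1) * J := by
      rw [hJ]; field_simp
    rw [e, h.localTrace_self, e']
    field_simp
    ring
  rw [h.ricci_conformal hs hs0 hB', htr, hH]
  field_simp
  ring

end IsLocalMetric

end LocalRicci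

/-! ### Coordinate expressions -/

section Charts

open Filter

variable {d : ℕ} {M : Type*} [TopologicalSpace M] [ChartedSpace (Coord d) M]
  [IsManifold (𝓡 d) ∞ M]

omit [IsManifold (𝓡 d) ∞ M] in
theorem pointAt_mem_source {p : M} {y : Coord d} (hy : y ∈ (extChartAt (𝓡 d) p).target) :
    pointAt p y ∈ (chartAt (Coord d) p).source := by
  rw [← extChartAt_source (𝓡 d)]
  exact (extChartAt (𝓡 d) p).map_target hy

omit [IsManifold (𝓡 d) ∞ M] in
theorem eventually_mem_target {p : M} {y : Coord d} (hy : y ∈ (extChartAt (𝓡 d) p).target) :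
    ∀ᶠ z in 𝓝 y, z ∈ (extChartAt (𝓡 d) p).target :=
  (isOpen_extChartAt_target p).mem_nhds hy

omit [IsManifold (𝓡 d) ∞ M] in
theorem pointAt_extChartAt (p : M) : pointAt p (extChartAt (𝓡 d) p p) = p :=
  extChartAt_to_inv p

theorem comps_ofComps {p q : M} (hq : q ∈ (chartAt (Coord d) p).source) (u : Coord d) :
    comps p q (ofComps p q u) = u :=
  (trivializationAt (Coord d) (TangentSpace (𝓡 d)) p).continuousLinearMapAt_symmL (R := ℝ) hq u

theorem ofComps_comps {p q : M} (hq : q ∈ (chartAt (Coord d) p).source)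
    (X : TangentSpace (𝓡 d) q) : ofComps p q (comps p q X) = X :=
  (trivializationAt (Coord d) (TangentSpace (𝓡 d)) p).symmL_continuousLinearMapAt (R := ℝ) hq X

theorem contMDiffAt_pointAt {p : M} {y : Coord d} (hy : y ∈ (extChartAt (𝓡 d) p).target) :
    ContMDiffAt 𝓘(ℝ, Coord d) (𝓡 d) ∞ (pointAt p) y :=
  (contMDiffOn_extChartAt_symm p).contMDiffAt ((isOpen_extChartAt_target p).mem_nhds hy)

theorem contDiffAt_comp_pointAt {F : Type*} [NormedAddCommGroup F] [NormedSpace ℝ F]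
    {f : M → F} {p : M} {y : Coord d} (hy : y ∈ (extChartAt (𝓡 d) p).target)
    (hf : ContMDiffAt (𝓡 d) 𝓘(ℝ, F) ∞ f (pointAt p y)) :
    ContDiffAt ℝ ∞ (fun z => f (pointAt p z)) y :=
  contMDiffAt_iff_contDiffAt.1 (hf.comp y (contMDiffAt_pointAt hy))

/-- The trivialization at `p` is the one induced by the chart at `p`, over the whole chart domain.
Hence forms read in coordinates obey the chain rule near the centre and not just at it. -/
theorem ofComps_eq_mfderiv {p : M} {y : Coord d} (hy : y ∈ (extChartAt (𝓡 d) p).target) :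
    ofComps p (pointAt p y) = mfderiv 𝓘(ℝ, Coord d) (𝓡 d) (pointAt p) y := by
  have h := TangentBundle.symmL_trivializationAt (𝕜 := ℝ) (I := 𝓡 d) (pointAt_mem_source hy)
  rw [(extChartAt (𝓡 d) p).right_inv hy] at h
  rw [ofComps, h, (𝓡 d).range_eq_univ, mfderivWithin_univ]

theorem mvfderiv_ofComps {f : M → ℝ} {p : M} {y : Coord d}
    (hy : y ∈ (extChartAt (𝓡 d) p).target) (hf : MDifferentiableAt (𝓡 d) 𝓘(ℝ, ℝ) f (pointAt p y)) :
    (mvfderiv (𝓡 d) f (pointAt p y)).comp (ofComps p (pointAt p y)) =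
      fderiv ℝ (fun z => f (pointAt p z)) y := by
  have h := mfderiv_comp y hf ((contMDiffAt_pointAt hy).mdifferentiableAt (by decide))
  rw [mfderiv_eq_fderiv] at h
  rw [ofComps_eq_mfderiv hy]
  exact h.symm

theorem mvfderiv_eq_fderiv {f : M → ℝ} {p : M} (hf : MDifferentiableAt (𝓡 d) 𝓘(ℝ, ℝ) f p)
    (X : TangentSpace (𝓡 d) p) :
    mvfderiv (𝓡 d) f p X =
      fderiv ℝ (fun z => f (pointAt p z)) (extChartAt (𝓡 d) p p) (comps p p X) := by
  -- `pointAt p (extChartAt (𝓡 d) p p)` equals `p` only propositionally, so the tangent spaces are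
  -- different types; with a variable `q` the equality can be substituted.
  have key : ∀ q : M, q = p → ∀ v : Coord d,
      mvfderiv (𝓡 d) f q (ofComps p q v) = mvfderiv (𝓡 d) f p (ofComps p p v) := by
    rintro q rfl v
    rfl
  rw [← mvfderiv_ofComps (mem_extChartAt_target p) (by rwa [pointAt_extChartAt])]
  conv_lhs => rw [← ofComps_comps (mem_chart_source _ p) X]
  exact (key _ (pointAt_extChartAt p) _).symm

theorem metricInChart_self (G : BilinField d M) (p : M) (u v : Coord d) :
    metricInChart G p (extChartAt (𝓡 d) p p) u v = G p (ofComps p p u) (ofComps p p v) := by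
  have key : ∀ q : M, q = p → G q (ofComps p q u) (ofComps p q v) =
      G p (ofComps p p u) (ofComps p p v) := by
    rintro q rfl
    rfl
  exact key _ (pointAt_extChartAt p)

theorem metricInChart_comps (G : BilinField d M) (p : M) (X Y : TangentSpace (𝓡 d) p) :
    metricInChart G p (extChartAt (𝓡 d) p p) (comps p p X) (comps p p Y) = G p X Y := by
  rw [metricInChart_self, ofComps_comps (mem_chart_source _ p),
    ofComps_comps (mem_chart_source _ p)]

theorem fieldInChart_self (N : ∀ q : M, TangentSpace (𝓡 d) q) (p : M) :
    fieldInChart N p (extChartAt (𝓡 d) p p) = comps p p (N p) := by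
  have key : ∀ q : M, q = p → comps p q (N q) = comps p p (N p) := by
    rintro q rfl
    rfl
  exact key _ (pointAt_extChartAt p)

/-- In the trivialization at `p` this coordinate field has constant components. -/
theorem contMDiffAt_ofComps {p q : M} (hq : q ∈ (chartAt (Coord d) p).source) (u : Coord d) :
    ContMDiffAt (𝓡 d) ((𝓡 d).prod 𝓘(ℝ, Coord d)) ∞
      (fun r : M => TotalSpace.mk' (Coord d) (E := fun q : M => TangentSpace (𝓡 d) q) r
        (ofComps p r u)) q := by
  let e := trivializationAt (Coord d) (TangentSpace (𝓡 d) : M → Type _) p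
  refine (e.contMDiffAt_section_iff (hx₀ := hq)).2 ?_
  refine (contMDiffAt_const (c := u)).congr_of_eventuallyEq ?_
  filter_upwards [(chartAt (Coord d) p).open_source.mem_nhds hq] with r hr
  have := comps_ofComps hr u
  simp only [comps, Trivialization.continuousLinearMapAt_apply] at this
  rwa [Trivialization.coe_linearMapAt_of_mem] at this
  exact hr

theorem contMDiffAt_field_iff {N : ∀ q : M, TangentSpace (𝓡 d) q} {p q : M}
    (hq : q ∈ (chartAt (Coord d) p).source) :
    ContMDiffAt (𝓡 d) ((𝓡 d).prod 𝓘(ℝ, Coord d)) ∞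
      (fun r => TotalSpace.mk' (Coord d) (E := fun q : M => TangentSpace (𝓡 d) q) r (N r)) q ↔
    ContMDiffAt (𝓡 d) 𝓘(ℝ, Coord d) ∞ (fun r => comps p r (N r)) q := by
  let e := trivializationAt (Coord d) (TangentSpace (𝓡 d) : M → Type _) p
  refine (e.contMDiffAt_section_iff (hx₀ := hq)).trans ?_
  refine Filter.EventuallyEq.contMDiffAt_iff ?_
  filter_upwards [(chartAt (Coord d) p).open_source.mem_nhds hq] with r hr
  simp only [comps, Trivialization.continuousLinearMapAt_apply]
  rw [Trivialization.coe_linearMapAt_of_mem]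
  exact hr

theorem contDiffAt_fieldInChart {N : ∀ q : M, TangentSpace (𝓡 d) q} {p : M}
    (hN : ContMDiffAt (𝓡 d) ((𝓡 d).prod 𝓘(ℝ, Coord d)) ∞
      (fun r => TotalSpace.mk' (Coord d) (E := fun q : M => TangentSpace (𝓡 d) q) r (N r)) p) :
    ContDiffAt ℝ ∞ (fieldInChart N p) (extChartAt (𝓡 d) p p) := by
  refine contDiffAt_comp_pointAt (f := fun r => comps p r (N r)) (mem_extChartAt_target p) ?_
  rw [pointAt_extChartAt]
  exact (contMDiffAt_field_iff (mem_chart_source _ p)).1 hN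

/-- A basis of `E` identifies `E →L[ℝ] F` with finitely many copies of `F`, by evaluation on the
basis vectors. -/
theorem contDiffAt_clm_of_apply {D E F : Type*} [NormedAddCommGroup D] [NormedSpace ℝ D]
    [NormedAddCommGroup E] [NormedSpace ℝ E] [FiniteDimensional ℝ E] [NormedAddCommGroup F]
    [NormedSpace ℝ F] {n : WithTop ℕ∞} {f : D → E →L[ℝ] F} {x : D}
    (h : ∀ v, ContDiffAt ℝ n (fun z => f z v) x) : ContDiffAt ℝ n f x := by
  let k := Module.finrank ℝ E
  have hk : k = Module.finrank ℝ (Fin k → ℝ) := (Module.finrank_fin_fun ℝ).symm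
  let e₁ := ContinuousLinearEquiv.ofFinrankEq hk
  let e₂ := (e₁.arrowCongr (1 : F ≃L[ℝ] F)).trans (ContinuousLinearEquiv.piRing (Fin k))
  rw [← Function.id_comp f, ← e₂.symm_comp_self]
  exact e₂.symm.contDiff.contDiffAt.comp x (contDiffAt_pi.2 fun i => h _)

/-- It suffices to treat the entries of `G` on pairs of coordinate fields, which are smooth
sections. -/
theorem contDiffAt_metricInChart {G : BilinField d M} {p : M} {y : Coord d}
    (hy : y ∈ (extChartAt (𝓡 d) p).target)
    (hG : ContMDiffAt (𝓡 d) ((𝓡 d).prod 𝓘(ℝ, Coord d →L[ℝ] Coord d →L[ℝ] ℝ)) ∞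
      (fun q => TotalSpace.mk' (Coord d →L[ℝ] Coord d →L[ℝ] ℝ)
        (E := fun q : M => TangentSpace (𝓡 d) q →L[ℝ] TangentSpace (𝓡 d) q →L[ℝ] ℝ)
        q (G q)) (pointAt p y)) :
    ContDiffAt ℝ ∞ (metricInChart G p) y := by
  refine contDiffAt_clm_of_apply fun u => contDiffAt_clm_of_apply fun v => ?_
  have hq := pointAt_mem_source hy
  have h := ContMDiffAt.clm_bundle_apply₂ (b := fun q : M => q) (F₁ := Coord d) (F₂ := Coord d)
    (F₃ := ℝ) (E₃ := fun _ : M => ℝ) hG (contMDiffAt_ofComps hq u) (contMDiffAt_ofComps hq v)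
  have h' : ContMDiffAt (𝓡 d) 𝓘(ℝ, ℝ) ∞
      (fun q => G q (ofComps p q u) (ofComps p q v)) (pointAt p y) := by
    have := (contMDiffAt_section (pointAt p y)).1 h
    simpa using this
  exact contDiffAt_comp_pointAt hy h'

theorem RMetric.contDiffAt_metricInChart (g : RMetric d M) {p : M} {y : Coord d}
    (hy : y ∈ (extChartAt (𝓡 d) p).target) : ContDiffAt ℝ ∞ (metricInChart g.inner p) y :=
  ConfGeom.contDiffAt_metricInChart hy (g.contMDiff _)

theorem RMetric.metricInChart_pos (g : RMetric d M) {p : M} {y : Coord d}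
    (hy : y ∈ (extChartAt (𝓡 d) p).target) (v : Coord d) (hv : v ≠ 0) :
    0 < metricInChart g.inner p y v v := by
  refine g.pos _ _ fun h => hv ?_
  exact (comps_ofComps (pointAt_mem_source hy) v).symm.trans
    ((congrArg _ h).trans (map_zero _))

theorem RMetric.isLocalMetric (g : RMetric d M) {p : M} {y : Coord d}
    (hy : y ∈ (extChartAt (𝓡 d) p).target) : IsLocalMetric (metricInChart g.inner p) y where
  contDiffAt := (g.contDiffAt_metricInChart hy).of_le ENat.LEInfty.out
  symm := Eventually.of_forall fun _ _ _ => g.symm _ _ _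
  pos := (eventually_mem_target hy).mono fun _ hz => g.metricInChart_pos hz

/-- Both sides have the same product with every vector: raising an index commutes with passing to
coordinates. -/
theorem RMetric.inverse_metricInChart (g : RMetric d M) {p : M} {y : Coord d}
    (hy : y ∈ (extChartAt (𝓡 d) p).target) (α : TangentSpace (𝓡 d) (pointAt p y) →L[ℝ] ℝ) :
    (metricInChart g.inner p y).inverse (α.comp (ofComps p (pointAt p y))) =
      comps p (pointAt p y) (sharp g.inner _ α) := by
  refine eq_of_forall_apply_eq_of_pos (g.metricInChart_pos hy) fun w => ?_
  rw [apply_inverse_apply_of_pos (g.metricInChart_pos hy), metricInChart_apply,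
    ofComps_comps (pointAt_mem_source hy), g.inner_sharp]
  rfl

theorem RMetric.coInner_eq (g : RMetric d M) {p : M} {y : Coord d}
    (hy : y ∈ (extChartAt (𝓡 d) p).target) (α β : TangentSpace (𝓡 d) (pointAt p y) →L[ℝ] ℝ) :
    coInner g.inner (pointAt p y) α β = α.comp (ofComps p (pointAt p y))
      ((metricInChart g.inner p y).inverse (β.comp (ofComps p (pointAt p y)))) := by
  rw [g.inverse_metricInChart hy, ContinuousLinearMap.comp_apply,
    ofComps_comps (pointAt_mem_source hy)]
  rfl

theorem christoffel_eq (G : BilinField d M) (p : M) :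
    christoffel G p = localChristoffel (metricInChart G p) := rfl

theorem ricci_eq (G : BilinField d M) (p : M) (X Y : TangentSpace (𝓡 d) p) :
    ricci G p X Y = localRicci (metricInChart G p) (extChartAt (𝓡 d) p p) (comps p p X)
      (comps p p Y) := rfl

theorem scalarCurv_eq (G : BilinField d M) (p : M) :
    scalarCurv G p = localTrace (metricInChart G p) (extChartAt (𝓡 d) p p)
      (localRicci (metricInChart G p) (extChartAt (𝓡 d) p p)) := rfl

/-- A function with vanishing differential on a connected manifold is constant. -/
theorem apply_eq_of_mvfderiv_eq_zero [PreconnectedSpace M] {f : M → ℝ}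
    (hf : MDifferentiable (𝓡 d) 𝓘(ℝ, ℝ) f) (h : ∀ p, mvfderiv (𝓡 d) f p = 0) (p q : M) :
    f p = f q := by
  refine IsLocallyConstant.apply_eq_of_preconnectedSpace (f := f)
    ((IsLocallyConstant.iff_eventually_eq f).2 fun r => ?_) p q
  -- A ball inside the chart is convex, so the vanishing derivative makes `f` constant on it; local
  -- constancy then globalises by connectedness.
  obtain ⟨ε, hε, hb⟩ := Metric.isOpen_iff.1 (isOpen_extChartAt_target (I := 𝓡 d) r) _
    (mem_extChartAt_target r)
  have hd : ∀ y ∈ Metric.ball (extChartAt (𝓡 d) r r) ε,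
      HasFDerivAt (fun z => f (pointAt r z)) (0 : Coord d →L[ℝ] ℝ) y := fun y hy => by
    have h₁ : DifferentiableAt ℝ (fun z => f (pointAt r z)) y :=
      mdifferentiableAt_iff_differentiableAt.1 ((hf _).comp y
        ((contMDiffAt_pointAt (hb hy)).mdifferentiableAt (by decide)))
    have h₂ := mvfderiv_ofComps (hb hy) (hf _)
    rw [h] at h₂
    refine h₁.hasFDerivAt.congr_fderiv ?_
    rw [← h₂]
    exact ContinuousLinearMap.zero_comp _
  have hU : extChartAt (𝓡 d) r ⁻¹' Metric.ball (extChartAt (𝓡 d) r r) ε ∈ 𝓝 r :=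
    (continuousAt_extChartAt r) (Metric.ball_mem_nhds _ hε)
  filter_upwards [hU, extChartAt_source_mem_nhds (I := 𝓡 d) r] with x hx hx'
  have := (convex_ball (extChartAt (𝓡 d) r r) ε).is_const_of_fderivWithin_eq_zero (𝕜 := ℝ)
    (f := fun z => f (pointAt r z))
    (fun y hy => (hd y hy).differentiableAt.differentiableWithinAt)
    (fun y hy => by
      rw [fderivWithin_of_isOpen Metric.isOpen_ball hy, (hd y hy).fderiv])
    hx (Metric.mem_ball_self hε)
  rwa [show pointAt r (extChartAt (𝓡 d) r x) = x from (extChartAt (𝓡 d) r).left_inv hx',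
    pointAt_extChartAt] at this

end Charts

/-! ### Hypersurfaces given as zero sets -/

section ZeroSets

open Filter

/-! ### Zero sets and their unit normals on a vector space -/

section Local

variable {E : Type*} [NormedAddCommGroup E] [NormedSpace ℝ E] {t φ : E → ℝ} {y : E}

/-- The derivative of a function that vanishes on the zero set of `t` annihilates the kernel of the
derivative of `t`. -/
theorem fderiv_apply_eq_zero_of_zero_set [CompleteSpace E] (ht : ContDiffAt ℝ 1 t y)
    (hφ : ContDiffAt ℝ 1 φ y)
    (ht0 : t y = 0) (ht' : fderiv ℝ t y ≠ 0) (h : ∀ᶠ z in 𝓝 y, t z = 0 → φ z = 0) {x : E}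
    (hx : fderiv ℝ t y x = 0) : fderiv ℝ φ y x = 0 := by
  -- Since `φ` vanishes on the zero set, `y` is trivially a constrained extremum. Lagrange
  -- multipliers give `a dt + b dφ = 0`, and `b ≠ 0` because `dt ≠ 0`.
  have hextr : IsLocalExtrOn φ {z | t z = t y} y := by
    refine Or.inl ?_
    filter_upwards [mem_nhdsWithin_of_mem_nhds h, self_mem_nhdsWithin] with z hz hz'
    rw [h.self_of_nhds ht0, hz (by rw [← ht0]; exact hz')]
  obtain ⟨a, b, hab, h'⟩ := hextr.exists_multipliers_of_hasStrictFDerivAt_1d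
    (ht.hasStrictFDerivAt (by decide)) (hφ.hasStrictFDerivAt (by decide))
  have hb : b ≠ 0 := by
    rintro rfl
    have ha : a ≠ 0 := fun ha => hab (by rw [ha]; rfl)
    exact ht' ((smul_eq_zero.1 (by simpa using h')).resolve_left ha)
  have := DFunLike.congr_fun h' x
  simpa [hx, hb] using this

variable [FiniteDimensional ℝ E] {B B' : E → E →L[ℝ] E →L[ℝ] ℝ} {s : E → ℝ} {N : E → E} {S r : ℝ}

omit [FiniteDimensional ℝ E] in
/-- A covector that annihilates the kernel of `β` is a multiple of `β`. -/
theorem eq_smul_of_ker_le {b : E →L[ℝ] E →L[ℝ] ℝ} {α β : E →L[ℝ] ℝ}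
    (hS : β (b.inverse β) ≠ 0) (h : ∀ v, β v = 0 → α v = 0) :
    α = (α (b.inverse β) / β (b.inverse β)) • β := by
  ext v
  -- The vector dual to `β` is transverse to `ker β`, so subtracting a multiple of it moves `v` into
  -- the kernel.
  have := h (v - (β v / β (b.inverse β)) • b.inverse β) (by
    rw [map_sub, map_smul, smul_eq_mul, div_mul_cancel₀ _ hS, sub_self])
  rw [map_sub, map_smul, sub_eq_zero] at this
  rw [this, smul_apply, smul_eq_mul, smul_eq_mul]
  ring

/-- The unit normal `N`, for the metric `s^{-2} B`, of the zero set of a function `t` whose gradient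
has constant length `√S` with respect to `B`. -/
theorem IsLocalMetric.unit_normal (h : IsLocalMetric B y) (hs0 : s y ≠ 0)
    (hB' : B' y = (s y ^ 2)⁻¹ • B y) (hS : 0 < S)
    (hgrad : fderiv ℝ t y ((B y).inverse (fderiv ℝ t y)) = S)
    (hunit : B' y (N y) (N y) = 1)
    (hnormal : ∀ v, fderiv ℝ t y v = 0 → B' y (N y) v = 0) :
    B' y (N y) = ((s y)⁻¹ * fderiv ℝ t y (N y) / S * (s y)⁻¹) • fderiv ℝ t y ∧
      ((s y)⁻¹ * fderiv ℝ t y (N y) / S) ^ 2 * S = 1 := by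
  -- The form dual to `N` kills `ker dt`, hence is a multiple of `dt`; evaluation on the gradient of
  -- `t` finds the factor, and the unit length then normalises it.
  have h₁ := eq_smul_of_ker_le (b := B y) (by rw [hgrad]; exact hS.ne') hnormal
  have h₂ : B' y (N y) ((B y).inverse (fderiv ℝ t y)) = (s y ^ 2)⁻¹ * fderiv ℝ t y (N y) := by
    rw [hB', smul_apply, smul_apply, h.symm_self, apply_inverse_apply_of_pos h.pos_self,
      smul_eq_mul]
  rw [hgrad, h₂] at h₁
  constructor
  · rw [h₁]
    congr 1
    field_simp
  · have h₃ := hunit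
    rw [h₁, smul_apply, smul_eq_mul] at h₃
    field_simp at h₃ ⊢
    linarith

/-- The Weingarten map, for the metric `s^{-2} B`, of the zero set of a function `t` whose gradient
has constant length `√S` and whose Hessian is pure trace with respect to `B`. -/
theorem IsLocalMetric.weingarten_zero_set (h : IsLocalMetric B y) (hs : ContDiffAt ℝ 2 s y)
    (ht : ContDiffAt ℝ 2 t y) (hs0 : s y ≠ 0) (ht0 : t y = 0)
    (hB' : B' =ᶠ[𝓝 y] fun z => (s z ^ 2)⁻¹ • B z) (hN : ContDiffAt ℝ 1 N y) (hS : 0 < S)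
    (hgrad : ∀ᶠ z in 𝓝 y, t z = 0 → fderiv ℝ t z ((B z).inverse (fderiv ℝ t z)) = S)
    (hunit : ∀ᶠ z in 𝓝 y, t z = 0 → B' z (N z) (N z) = 1)
    (hnormal : ∀ᶠ z in 𝓝 y, t z = 0 → ∀ v, fderiv ℝ t z v = 0 → B' z (N z) v = 0)
    (hr : localHessian B t y = -r • B y) {x : E} (hx : fderiv ℝ t y x = 0) :
    fderiv ℝ N y x + localChristoffel B' y x (N y) =
      -((s y)⁻¹ * fderiv ℝ t y (N y) / S *
        (s y * r + fderiv ℝ s y ((B y).inverse (fderiv ℝ t y)))) • x := by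
  have : CompleteSpace E := FiniteDimensional.complete ℝ E
  have h' := h.congr hs hs0 hB'
  have ht₁ : ContDiffAt ℝ 1 t y := ht.of_le (by decide)
  have hs₁ : ContDiffAt ℝ 1 s y := hs.of_le (by decide)
  have hdt : ContDiffAt ℝ 1 (fderiv ℝ t) y := ht.fderiv_right (by decide)
  have ht' : fderiv ℝ t y ≠ 0 := fun h0 => by
    have := hgrad.self_of_nhds ht0
    rw [h0, zero_apply] at this
    exact hS.ne this
  have hBN : ContDiffAt ℝ 1 (fun z => B' z (N z)) y :=
    (h'.contDiffAt.of_le (by decide)).clm_apply hN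
  set e : E → ℝ := fun z => (s z)⁻¹ * fderiv ℝ t z (N z) / S with he
  have hec : ContDiffAt ℝ 1 e y := ((hs₁.inv hs0).mul (hdt.clm_apply hN)).div_const S
  have key : ∀ᶠ z in 𝓝 y, t z = 0 →
      B' z (N z) = (e z * (s z)⁻¹) • fderiv ℝ t z ∧ e z ^ 2 * S = 1 := by
    filter_upwards [h.eventually, hs.continuousAt.eventually_ne hs0, hB', hgrad, hunit, hnormal]
      with z h₁ h₂ h₃ h₄ h₅ h₆ hz
    exact h₁.unit_normal h₂ h₃ hS (h₄ hz) (h₅ hz) (h₆ hz)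
  -- On the zero set `e² S = 1`, so `e` has vanishing tangential derivative; no choice of sign for
  -- the normal is needed.
  have he' : fderiv ℝ e y x = 0 := by
    have h₁ := fderiv_apply_eq_zero_of_zero_set (φ := fun z => e z ^ 2 * S - 1) ht₁
      (((hec.pow 2).mul contDiffAt_const).sub contDiffAt_const) ht0 ht'
      (by filter_upwards [key] with z hz hz'; rw [(hz hz').2, sub_self]) hx
    have h₂ := (((hec.differentiableAt (by decide)).hasFDerivAt.pow 2).mul_const S).sub_const 1
    have h₃ : fderiv ℝ (fun z => e z ^ 2 * S - 1) y = _ := h₂.fderiv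
    rw [h₃] at h₁
    have h₄ : e y ≠ 0 := fun h0 => by simpa [h0] using (key.self_of_nhds ht0).2
    simpa [h₄, hS.ne'] using h₁
  refine h.weingarten_conformal (t := t) (a := e y) hs hs0 hB' (hN.differentiableAt (by decide)) hx
    (key.self_of_nhds ht0).1 ?_ (by rw [hr]; rfl)
  ext w
  have hsi := hasFDerivAt_fun_inv (hs₁.differentiableAt (by decide)).hasFDerivAt hs0
  -- The form dual to `N` agrees with `e s⁻¹ dt` only where `t = 0`, so each component of the
  -- difference is differentiated along the tangent vector `x`.
  have h₁ := fderiv_apply_eq_zero_of_zero_set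
    (φ := fun z => B' z (N z) w - e z * (s z)⁻¹ * fderiv ℝ t z w) ht₁
    ((hBN.clm_apply contDiffAt_const).sub
      ((hec.mul (hs₁.inv hs0)).mul (hdt.clm_apply contDiffAt_const))) ht0 ht'
    (by filter_upwards [key] with z hz hz'; rw [(hz hz').1]; simp) hx
  have h₂ := ((hBN.differentiableAt (by decide)).hasFDerivAt.clm_apply
    (hasFDerivAt_const w y)).sub
    (((hec.differentiableAt (by decide)).hasFDerivAt.mul hsi).mul
      ((hdt.differentiableAt (by decide)).hasFDerivAt.clm_apply (hasFDerivAt_const w y)))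
  have h₃ : fderiv ℝ (fun z => B' z (N z) w - e z * (s z)⁻¹ * fderiv ℝ t z w) y = _ := h₂.fderiv
  rw [h₃] at h₁
  simp [he'] at h₁
  simp only [smul_apply, sub_apply, smul_eq_mul]
  linear_combination h₁

end Local

/-! ### Zero sets on the manifold -/

variable {d : ℕ} {M : Type*} [TopologicalSpace M] [ChartedSpace (Coord d) M]
  [IsManifold (𝓡 d) ∞ M]

theorem continuousAt_pointAt (p : M) : ContinuousAt (pointAt p) (extChartAt (𝓡 d) p p) :=
  (contMDiffAt_pointAt (mem_extChartAt_target p)).continuousAt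

theorem eventually_pointAt {p : M} {P : M → Prop} (h : ∀ᶠ q in 𝓝 p, P q) :
    ∀ᶠ z in 𝓝 (extChartAt (𝓡 d) p p), P (pointAt p z) := by
  have := continuousAt_pointAt (d := d) p
  rw [ContinuousAt, pointAt_extChartAt] at this
  exact this.eventually h

omit [IsManifold (𝓡 d) ∞ M] in
theorem contMDiffAt_of_comp_pointAt {F : Type*} [NormedAddCommGroup F] [NormedSpace ℝ F]
    {f : M → F} {p : M}
    (hf : ContDiffAt ℝ ∞ (fun z => f (pointAt p z)) (extChartAt (𝓡 d) p p)) :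
    ContMDiffAt (𝓡 d) 𝓘(ℝ, F) ∞ f p := by
  refine (hf.contMDiffAt.comp p contMDiffAt_extChartAt).congr_of_eventuallyEq ?_
  filter_upwards [extChartAt_source_mem_nhds (I := 𝓡 d) p] with q hq
  exact congrArg f ((extChartAt (𝓡 d) p).left_inv hq).symm

theorem contDiffAt_comp_pointAt_self {F : Type*} [NormedAddCommGroup F] [NormedSpace ℝ F]
    {f : M → F} {p : M} (hf : ContMDiffAt (𝓡 d) 𝓘(ℝ, F) ∞ f p) :
    ContDiffAt ℝ ∞ (fun z => f (pointAt p z)) (extChartAt (𝓡 d) p p) :=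
  contDiffAt_comp_pointAt (mem_extChartAt_target p) (by rwa [pointAt_extChartAt])

/-- The tangent space of a zero set is the kernel of the differential. -/
theorem mem_tangentTo_iff {f : M → ℝ} (hf : ContMDiff (𝓡 d) 𝓘(ℝ, ℝ) ∞ f) {p : M} (hp : f p = 0)
    (h : mvfderiv (𝓡 d) f p ≠ 0) (X : TangentSpace (𝓡 d) p) :
    X ∈ tangentTo d {q | f q = 0} p ↔ mvfderiv (𝓡 d) f p X = 0 := by
  refine ⟨fun hX => hX univ f isOpen_univ (mem_univ _) hf.contMDiffOn fun q hq => hq.1, ?_⟩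
  -- For an arbitrary test function `φ` the claim is the Lagrange multiplier lemma, read in the
  -- chart at `p`.
  intro hX U φ hU hpU hφ h0
  have hfp := hf p
  have hφp := hφ.contMDiffAt (hU.mem_nhds hpU)
  rw [mvfderiv_eq_fderiv (hfp.mdifferentiableAt (by decide))] at hX
  rw [mvfderiv_eq_fderiv (hφp.mdifferentiableAt (by decide))]
  refine fderiv_apply_eq_zero_of_zero_set (t := fun z => f (pointAt p z))
    ((contDiffAt_comp_pointAt_self hfp).of_le ENat.LEInfty.out)
    ((contDiffAt_comp_pointAt_self hφp).of_le ENat.LEInfty.out) ?_ ?_ ?_ hX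
  · rwa [pointAt_extChartAt]
  · intro h'
    refine h (ContinuousLinearMap.ext fun Y => ?_)
    rw [mvfderiv_eq_fderiv (hfp.mdifferentiableAt (by decide)), h']
    rfl
  · filter_upwards [eventually_pointAt (hU.mem_nhds hpU)] with z hz hz'
    exact h0 _ ⟨hz', hz⟩

end ZeroSets

/-! ### Parallel tractors in coordinates and constancy of the tractor metric -/

section ParallelTractors

open Filter

variable {d : ℕ} {M : Type*} [TopologicalSpace M] [ChartedSpace (Coord d) M]
  [IsManifold (𝓡 d) ∞ M]

/-- At the centre of the chart, `inverse_metricInChart` is stated for covectors at `pointAt p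
(extChartAt (𝓡 d) p p)`; this version takes covectors at `p` itself. -/
theorem RMetric.inverse_metricInChart_self (g : RMetric d M) (p : M)
    (α : TangentSpace (𝓡 d) p →L[ℝ] ℝ) :
    (metricInChart g.inner p (extChartAt (𝓡 d) p p)).inverse (α.comp (ofComps p p)) =
      comps p p (sharp g.inner p α) := by
  have hpos := g.metricInChart_pos (mem_extChartAt_target (I := 𝓡 d) p)
  refine eq_of_forall_apply_eq_of_pos hpos fun w => ?_
  rw [apply_inverse_apply_of_pos hpos, metricInChart_self,
    ofComps_comps (mem_chart_source _ p), g.inner_sharp]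
  rfl

theorem mvfderiv_comp_ofComps {f : M → ℝ} {p : M}
    (hf : MDifferentiableAt (𝓡 d) 𝓘(ℝ, ℝ) f p) :
    (mvfderiv (𝓡 d) f p).comp (ofComps p p) =
      fderiv ℝ (fun z => f (pointAt p z)) (extChartAt (𝓡 d) p p) := by
  ext u
  rw [ContinuousLinearMap.comp_apply, mvfderiv_eq_fderiv hf, comps_ofComps (mem_chart_source _ p)]

namespace Tractor

variable {c : ConformalStructure d M} {K L : Tractor c}

theorem contMDiff_sigma (K : Tractor c) (g : Scale c) : ContMDiff (𝓡 d) 𝓘(ℝ, ℝ) ∞ (K.sigma g) :=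
  (K.2.1 g).fst

theorem contMDiff_rho (K : Tractor c) (g : Scale c) : ContMDiff (𝓡 d) 𝓘(ℝ, ℝ) ∞ (K.rho g) :=
  (K.2.1 g).last

/-- The first component of a tractor, in the coordinates around `p`. -/
noncomputable def sigmaInChart (K : Tractor c) (g : Scale c) (p : M) (z : Coord d) : ℝ :=
  K.sigma g (pointAt p z)

theorem contDiffAt_sigmaInChart (K : Tractor c) (g : Scale c) {p : M} {y : Coord d}
    (hy : y ∈ (extChartAt (𝓡 d) p).target) : ContDiffAt ℝ ∞ (K.sigmaInChart g p) y :=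
  contDiffAt_comp_pointAt hy (K.contMDiff_sigma g _)

theorem sigmaInChart_self (K : Tractor c) (g : Scale c) (p : M) :
    K.sigmaInChart g p (extChartAt (𝓡 d) p p) = K.sigma g p := by
  rw [sigmaInChart, pointAt_extChartAt]

theorem fderiv_sigmaInChart_contDiffAt (K : Tractor c) (g : Scale c) {p : M} {y : Coord d}
    (hy : y ∈ (extChartAt (𝓡 d) p).target) : ContDiffAt ℝ ∞ (fderiv ℝ (K.sigmaInChart g p)) y :=
  (K.contDiffAt_sigmaInChart g hy).fderiv_right (by exact_mod_cast le_rfl)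

theorem metricInChart_scaleMetric (K : Tractor c) (g : Scale c) (p : M) (z : Coord d) :
    metricInChart K.scaleMetric p z =
      (K.sigmaInChart g p z ^ 2)⁻¹ • metricInChart g.1.inner p z := by
  ext u v
  simp only [metricInChart_apply, K.scaleMetric_eq g, smul_apply, sigmaInChart]

namespace IsParallel

/-- This is the first slot of the parallel equation. -/
theorem mu_eq (hK : K.IsParallel) (g : Scale c) (p : M) :
    K.mu g p = mvfderiv (𝓡 d) (K.sigma g) p := by
  ext X
  have := congrArg Prod.fst (hK g p X)
  exact (sub_eq_zero.1 this).symm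

theorem mu_comp_ofComps (hK : K.IsParallel) (g : Scale c) {p : M} {y : Coord d}
    (hy : y ∈ (extChartAt (𝓡 d) p).target) :
    (K.mu g (pointAt p y)).comp (ofComps p (pointAt p y)) = fderiv ℝ (K.sigmaInChart g p) y := by
  rw [hK.mu_eq]
  exact mvfderiv_ofComps hy ((K.contMDiff_sigma g _).mdifferentiableAt (by decide))

theorem formInChart_mu (hK : K.IsParallel) (g : Scale c) {p : M} {y : Coord d}
    (hy : y ∈ (extChartAt (𝓡 d) p).target) :
    formInChart (K.mu g) p =ᶠ[𝓝 y] fderiv ℝ (K.sigmaInChart g p) := by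
  filter_upwards [eventually_mem_target hy] with z hz using hK.mu_comp_ofComps g hz

theorem mu_apply (hK : K.IsParallel) (g : Scale c) (p : M) (X : TangentSpace (𝓡 d) p) :
    K.mu g p X = fderiv ℝ (K.sigmaInChart g p) (extChartAt (𝓡 d) p p) (comps p p X) := by
  rw [hK.mu_eq]
  exact mvfderiv_eq_fderiv ((K.contMDiff_sigma g _).mdifferentiableAt (by decide)) X

theorem inverse_metricInChart_fderiv (hK : K.IsParallel) (g : Scale c) (p : M) :
    (metricInChart g.1.inner p (extChartAt (𝓡 d) p p)).inverse
      (fderiv ℝ (K.sigmaInChart g p) (extChartAt (𝓡 d) p p)) =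
      comps p p (sharp g.1.inner p (K.mu g p)) := by
  rw [← g.1.inverse_metricInChart_self, hK.mu_eq,
    mvfderiv_comp_ofComps ((K.contMDiff_sigma g _).mdifferentiableAt (by decide))]
  rfl

theorem coInner_mu (hK : K.IsParallel) (hL : L.IsParallel) (g : Scale c) {p : M} {y : Coord d}
    (hy : y ∈ (extChartAt (𝓡 d) p).target) :
    coInner g.1.inner (pointAt p y) (K.mu g (pointAt p y)) (L.mu g (pointAt p y)) =
      fderiv ℝ (K.sigmaInChart g p) y
        ((metricInChart g.1.inner p y).inverse (fderiv ℝ (L.sigmaInChart g p) y)) := by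
  rw [g.1.coInner_eq hy, hK.mu_comp_ofComps g hy, hL.mu_comp_ofComps g hy]

theorem coInner_mu_self (hK : K.IsParallel) (hL : L.IsParallel) (g : Scale c) (p : M) :
    coInner g.1.inner p (K.mu g p) (L.mu g p) =
      fderiv ℝ (K.sigmaInChart g p) (extChartAt (𝓡 d) p p)
        ((metricInChart g.1.inner p (extChartAt (𝓡 d) p p)).inverse
          (fderiv ℝ (L.sigmaInChart g p) (extChartAt (𝓡 d) p p))) := by
  rw [hL.inverse_metricInChart_fderiv, ← hK.mu_apply]
  rfl

/-- Since `μ = dσ` near `p`, the form `∇μ` in the middle slot is the Hessian of `σ`. -/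
theorem localHessian_eq (hK : K.IsParallel) (g : Scale c) (p : M) (X Y : TangentSpace (𝓡 d) p) :
    localHessian (metricInChart g.1.inner p) (K.sigmaInChart g p) (extChartAt (𝓡 d) p p)
        (comps p p X) (comps p p Y) =
      -(g.1.inner p X Y * K.rho g p) - schouten g.1.inner p X Y * K.sigma g p := by
  have h := congrFun (congrArg (fun t => t.2.1) (hK g p X)) Y
  have e := hK.formInChart_mu g (mem_extChartAt_target (I := 𝓡 d) p)
  have h' : covDerivForm g.1.inner (K.mu g) p X Y + g.1.inner p X Y * K.rho g p +
    schouten g.1.inner p X Y * K.sigma g p = 0 := h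
  rw [covDerivForm, e.fderiv_eq, e.self_of_nhds, christoffel_eq] at h'
  rw [localHessian_apply]
  linear_combination h'

theorem mvfderiv_rho (hK : K.IsParallel) (g : Scale c) (p : M) (X : TangentSpace (𝓡 d) p) :
    mvfderiv (𝓡 d) (K.rho g) p X =
      schouten g.1.inner p X (sharp g.1.inner p (K.mu g p)) :=
  sub_eq_zero.1 (congrArg (fun t => t.2.2) (hK g p X))

theorem contDiffAt_coInner (hK : K.IsParallel) (hL : L.IsParallel) (g : Scale c) (p : M) :
    ContDiffAt ℝ ∞ (fun z => coInner g.1.inner (pointAt p z) (K.mu g (pointAt p z))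
      (L.mu g (pointAt p z))) (extChartAt (𝓡 d) p p) := by
  have hy := mem_extChartAt_target (I := 𝓡 d) p
  refine ((K.fderiv_sigmaInChart_contDiffAt g hy).clm_apply ((contDiffAt_inverse_of_pos
    (g.1.contDiffAt_metricInChart hy) (g.1.metricInChart_pos hy)).clm_apply
    (L.fderiv_sigmaInChart_contDiffAt g hy))).congr_of_eventuallyEq ?_
  filter_upwards [eventually_mem_target hy] with z hz using hK.coInner_mu hL g hz

theorem contMDiff_coInner (hK : K.IsParallel) (hL : L.IsParallel) (g : Scale c) :
    ContMDiff (𝓡 d) 𝓘(ℝ, ℝ) ∞ (fun q => coInner g.1.inner q (K.mu g q) (L.mu g q)) :=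
  fun p => contMDiffAt_of_comp_pointAt (hK.contDiffAt_coInner hL g p)

/-- The derivative is `Hess σ_K(X, grad σ_L) + Hess σ_L(X, grad σ_K)`. Each Hessian is `-ρ g - σ P`,
and by the last slot `P(X, grad σ)` is the derivative of `ρ`. -/
theorem mvfderiv_coInner (hK : K.IsParallel) (hL : L.IsParallel) (g : Scale c) (p : M)
    (X : TangentSpace (𝓡 d) p) :
    mvfderiv (𝓡 d) (fun q => coInner g.1.inner q (K.mu g q) (L.mu g q)) p X =
      -(L.mu g p X * K.rho g p) - mvfderiv (𝓡 d) (L.rho g) p X * K.sigma g p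
      -(K.mu g p X * L.rho g p) - mvfderiv (𝓡 d) (K.rho g) p X * L.sigma g p := by
  have hy := mem_extChartAt_target (I := 𝓡 d) p
  rw [mvfderiv_eq_fderiv ((hK.contMDiff_coInner hL g p).mdifferentiableAt (by decide))]
  have e : (fun z => coInner g.1.inner (pointAt p z) (K.mu g (pointAt p z))
      (L.mu g (pointAt p z))) =ᶠ[𝓝 (extChartAt (𝓡 d) p p)]
      fun z => fderiv ℝ (K.sigmaInChart g p) z
        ((metricInChart g.1.inner p z).inverse (fderiv ℝ (L.sigmaInChart g p) z)) := by
    filter_upwards [eventually_mem_target hy] with z hz using hK.coInner_mu hL g hz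
  rw [e.fderiv_eq, ((g.1.isLocalMetric hy).hasFDerivAt_inner_gradient
    ((K.contDiffAt_sigmaInChart g hy).of_le ENat.LEInfty.out)
    ((L.contDiffAt_sigmaInChart g hy).of_le ENat.LEInfty.out)).fderiv]
  rw [add_apply, ContinuousLinearMap.flip_apply, ContinuousLinearMap.flip_apply,
    hK.inverse_metricInChart_fderiv, hL.inverse_metricInChart_fderiv, hK.localHessian_eq,
    hL.localHessian_eq, hK.mvfderiv_rho, hL.mvfderiv_rho, g.1.symm p X, g.1.symm p X,
    g.1.inner_sharp, g.1.inner_sharp]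
  ring

/-- The tractor metric is constant on pairs of parallel tractors. -/
theorem inner_const [PreconnectedSpace M] (hK : K.IsParallel) (hL : L.IsParallel) (p q : M) :
    Tractor.inner K L p = Tractor.inner K L q := by
  let g := someScale c
  have hsK (p : M) := (K.contMDiff_sigma g p).mdifferentiableAt (by decide)
  have hsL (p : M) := (L.contMDiff_sigma g p).mdifferentiableAt (by decide)
  have hrK (p : M) := (K.contMDiff_rho g p).mdifferentiableAt (by decide)
  have hrL (p : M) := (L.contMDiff_rho g p).mdifferentiableAt (by decide)
  have hc (p : M) := (hK.contMDiff_coInner hL g p).mdifferentiableAt (by decide)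
  refine apply_eq_of_mvfderiv_eq_zero (f := Tractor.inner K L)
    (fun p => (((hsK p).mul (hrL p)).add ((hrK p).mul (hsL p))).add (hc p)) (fun p => ?_) p q
  have e : Tractor.inner K L = (K.sigma g * L.rho g + K.rho g * L.sigma g) +
    fun q => coInner g.1.inner q (K.mu g q) (L.mu g q) := rfl
  rw [e, mvfderiv_add (((hsK p).mul (hrL p)).add ((hrK p).mul (hsL p))) (hc p),
    mvfderiv_add ((hsK p).mul (hrL p)) ((hrK p).mul (hsL p)), mvfderiv_mul (hsK p) (hrL p),
    mvfderiv_mul (hrK p) (hsL p)]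
  ext X
  simp only [add_apply, smul_apply, smul_eq_mul, hK.mvfderiv_coInner hL, ← hK.mu_eq, ← hL.mu_eq,
    zero_apply]
  ring

end IsParallel

end Tractor

end ParallelTractors

/-! ### The Einstein metric of a parallel tractor -/

section ScaleMetric

open Filter

variable {d : ℕ} {M : Type*} [TopologicalSpace M] [ChartedSpace (Coord d) M]
  [IsManifold (𝓡 d) ∞ M] {c : ConformalStructure d M} {K L : Tractor c}

namespace Tractor

theorem isOpen_compl_singSet (K : Tractor c) : IsOpen K.singSetᶜ :=
  (isClosed_singleton.preimage (K.contMDiff_sigma (someScale c)).continuous).isOpen_compl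

theorem sigma_ne_zero {p : M} (hp : p ∈ K.singSetᶜ) (g : Scale c) : K.sigma g p ≠ 0 :=
  fun h => hp ((K.mem_singSet g p).2 h)

theorem isMetricOn_scaleMetric (K : Tractor c) : IsMetricOn K.scaleMetric K.singSetᶜ where
  symm p _ X Y := by
    simp only [scaleMetric, smul_apply, (someScale c).1.symm p X Y]
  pos p hp X hX := by
    have h₁ := (someScale c).1.pos p X hX
    have h₂ := sigma_ne_zero hp (someScale c)
    simp only [scaleMetric, smul_apply, smul_eq_mul]
    positivity
  smooth := by
    have h : ContMDiffOn (𝓡 d) 𝓘(ℝ, ℝ) ∞ (fun p => (K.sigma (someScale c) p ^ 2)⁻¹)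
        K.singSetᶜ := fun p hp =>
      ((((K.contMDiff_sigma _ p).pow 2).inv₀
        (pow_ne_zero 2 (sigma_ne_zero hp _)))).contMDiffWithinAt
    exact h.smul_section (someScale c).1.contMDiff.contMDiffOn

theorem metricInChart_scaleMetric_eventuallyEq (K : Tractor c) (g : Scale c) (p : M)
    (y : Coord d) :
    metricInChart K.scaleMetric p =ᶠ[𝓝 y] fun z =>
      (K.sigmaInChart g p z ^ 2)⁻¹ • metricInChart g.1.inner p z :=
  Eventually.of_forall fun z => K.metricInChart_scaleMetric g p z

theorem sigmaInChart_contDiffAt_two (K : Tractor c) (g : Scale c) (p : M) :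
    ContDiffAt ℝ 2 (K.sigmaInChart g p) (extChartAt (𝓡 d) p p) :=
  (K.contDiffAt_sigmaInChart g (mem_extChartAt_target p)).of_le ENat.LEInfty.out

/-- A parallel tractor determines an Einstein metric. -/
theorem IsParallel.ricci_scaleMetric (hd : 3 ≤ d) (hK : K.IsParallel) {p : M}
    (hp : p ∈ K.singSetᶜ) (X Y : TangentSpace (𝓡 d) p) :
    ricci K.scaleMetric p X Y = ((d : ℝ) - 1) * K.S p * K.scaleMetric p X Y := by
  let g := someScale c
  have hy := mem_extChartAt_target (I := 𝓡 d) p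
  have h0 : K.sigmaInChart g p (extChartAt (𝓡 d) p p) ≠ 0 := by
    rw [sigmaInChart_self]
    exact sigma_ne_zero hp g
  -- With `r = ρ` the required Hessian condition is the middle slot of the parallel equation, and
  -- the factor `2ρσ + |dσ|²` is `h(K, K) = -S_K`.
  rw [ricci_eq, (g.1.isLocalMetric hy).ricci_conformal_of_hessian hd
    (K.sigmaInChart_contDiffAt_two g p) h0 (K.metricInChart_scaleMetric_eventuallyEq g p _)
    (r := K.rho g p), metricInChart_comps, sigmaInChart_self, ← hK.coInner_mu_self hK,
    K.scaleMetric_eq g, S, inner_eq K K g, innerIn]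
  · simp only [smul_apply, smul_eq_mul]
    ring
  · intro u v
    have h := hK.localHessian_eq g p (ofComps p p u) (ofComps p p v)
    rw [schouten, ricci_eq, scalarCurv_eq, ← metricInChart_self] at h
    simp only [comps_ofComps (mem_chart_source _ p)] at h
    rw [h, sigmaInChart_self]
    ring

/-! ### The zero set of a parallel tractor as a hypersurface -/

section Hypersurface

/-- Where `σ = 0` the term `2ρσ` of `h(L, L)` drops out. -/
theorem coInner_mu_of_mem_singSet (g : Scale c) {p : M} (hp : p ∈ L.singSet) :
    coInner g.1.inner p (L.mu g p) (L.mu g p) = -L.S p := by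
  rw [S, inner_eq L L g, innerIn, (L.mem_singSet g p).1 hp]
  ring

theorem IsParallel.mvfderiv_sigma_ne_zero (hL : L.IsParallel) (g : Scale c) {p : M}
    (h : coInner g.1.inner p (L.mu g p) (L.mu g p) ≠ 0) : mvfderiv (𝓡 d) (L.sigma g) p ≠ 0 := by
  intro h0
  rw [hL.mu_eq, h0] at h
  exact h rfl

/-- On the zero set `|dσ|² = -S_L > 0`. The open set where `|dσ|²` is positive therefore serves as a
neighbourhood of all its points at once. -/
theorem IsParallel.isHypersurface_singSet (hL : L.IsParallel) (hS : ∀ p, L.S p < 0) :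
    IsHypersurface d L.singSet := by
  intro p hp
  let g := someScale c
  refine ⟨{q | 0 < coInner g.1.inner q (L.mu g q) (L.mu g q)}, L.sigma g,
    isOpen_lt continuous_const (hL.contMDiff_coInner hL g).continuous, ?_,
    (L.contMDiff_sigma g).contMDiffOn,
    fun q hq => hL.mvfderiv_sigma_ne_zero g (ne_of_gt hq), ?_⟩
  · rw [mem_ofPred_eq, coInner_mu_of_mem_singSet g hp]
    linarith [hS p]
  · ext q
    exact and_comm

theorem IsParallel.mem_tangentTo_singSet (hL : L.IsParallel) (hS : ∀ p, L.S p < 0) (g : Scale c)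
    {p : M} (hp : p ∈ L.singSet) (X : TangentSpace (𝓡 d) p) :
    X ∈ tangentTo d L.singSet p ↔ L.mu g p X = 0 := by
  have e : L.singSet = {q | L.sigma g q = 0} := Set.ext fun q => L.mem_singSet g q
  rw [hL.mu_eq, e]
  refine mem_tangentTo_iff (L.contMDiff_sigma g) ((L.mem_singSet g p).1 hp)
    (hL.mvfderiv_sigma_ne_zero g ?_) X
  rw [coInner_mu_of_mem_singSet g hp]
  linarith [hS p]

/-- In the product rule the derivative of `σ_K⁻¹` is multiplied by `σ_L = 0`. -/
theorem mvfderiv_ratio (hL : L.IsParallel) (g : Scale c) {p : M} (hp : p ∈ L.singSet)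
    (hpK : p ∈ K.singSetᶜ) (X : TangentSpace (𝓡 d) p) :
    mvfderiv (𝓡 d) (ratio L K) p X = L.mu g p X / K.sigma g p := by
  have e : ratio L K = fun q => L.sigma g q * (K.sigma g q)⁻¹ :=
    funext fun q => by rw [ratio_eq L K g, div_eq_mul_inv]
  have h₁ := (L.contMDiff_sigma g p).mdifferentiableAt (by decide)
  have h₂ : MDifferentiableAt (𝓡 d) 𝓘(ℝ, ℝ) (fun q => (K.sigma g q)⁻¹) p :=
    ((K.contMDiff_sigma g p).inv₀ (sigma_ne_zero hpK g)).mdifferentiableAt (by decide)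
  have h₃ := mvfderiv_mul h₁ h₂
  rw [(L.mem_singSet g p).1 hp] at h₃
  rw [e]
  refine (DFunLike.congr_fun h₃ X).trans ?_
  rw [hL.mu_eq]
  simp [div_eq_inv_mul]

/-- The extrinsic geometry of the zero set of `σ_L` with respect to the metric `σ_K^{-2} g`. -/
theorem IsParallel.weingarten [PreconnectedSpace M] (hd : 3 ≤ d) (hK : K.IsParallel)
    (hL : L.IsParallel) (hS : ∀ p, L.S p < 0) {U : Set M} {N : ∀ q : M, TangentSpace (𝓡 d) q}
    (hU : U ⊆ K.singSetᶜ) (hN : IsUnitNormal K.scaleMetric L.singSet U N) {p : M}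
    (hp : p ∈ L.singSet) (hpU : p ∈ U) :
    ∃ a : ℝ, a ^ 2 * -L.S p = 1 ∧
      mvfderiv (𝓡 d) (ratio L K) p (N p) = a * -L.S p ∧
      (∀ X ∈ tangentTo d L.singSet p, covDeriv K.scaleMetric N p X = -(a * inner K L p) • X) ∧
      meanCurvature K.scaleMetric N p = -(a * inner K L p) := by
  let g := someScale c
  have hy := mem_extChartAt_target (I := 𝓡 d) p
  have hsrc := mem_chart_source (Coord d) p
  set y := extChartAt (𝓡 d) p p with hy_def
  have hσ : K.sigma g p ≠ 0 := sigma_ne_zero (hU hpU) g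
  have hs0 : K.sigmaInChart g p y ≠ 0 := by rwa [sigmaInChart_self]
  have ht0 : L.sigmaInChart g p y = 0 := by
    rw [sigmaInChart_self]
    exact (L.mem_singSet g p).1 hp
  have hS' : 0 < -L.S p := by linarith [hS p]
  have hlm := g.1.isLocalMetric hy
  have hNs : ContDiffAt ℝ ∞ (fieldInChart N p) y :=
    contDiffAt_fieldInChart (hN.smooth.contMDiffAt (hN.isOpen.mem_nhds hpU))
  -- Constancy of `S_L` enters here: the length of the gradient is the same all along the zero set.
  have hgrad : ∀ᶠ z in 𝓝 y, L.sigmaInChart g p z = 0 →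
      fderiv ℝ (L.sigmaInChart g p) z ((metricInChart g.1.inner p z).inverse
        (fderiv ℝ (L.sigmaInChart g p) z)) = -L.S p := by
    filter_upwards [eventually_mem_target hy] with z hz h0
    rw [← hL.coInner_mu hL g hz, coInner_mu_of_mem_singSet g ((L.mem_singSet g _).2 h0), S, S,
      hL.inner_const hL]
  have hmem : ∀ᶠ z in 𝓝 y, z ∈ (extChartAt (𝓡 d) p).target ∧ pointAt p z ∈ U :=
    (eventually_mem_target hy).and (eventually_pointAt (hN.isOpen.mem_nhds hpU))
  have hunit : ∀ᶠ z in 𝓝 y, L.sigmaInChart g p z = 0 →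
      metricInChart K.scaleMetric p z (fieldInChart N p z) (fieldInChart N p z) = 1 := by
    filter_upwards [hmem] with z hz h0
    rw [metricInChart_apply, fieldInChart, ofComps_comps (pointAt_mem_source hz.1)]
    exact hN.unit _ ⟨(L.mem_singSet g _).2 h0, hz.2⟩
  have hnormal : ∀ᶠ z in 𝓝 y, L.sigmaInChart g p z = 0 → ∀ v,
      fderiv ℝ (L.sigmaInChart g p) z v = 0 →
        metricInChart K.scaleMetric p z (fieldInChart N p z) v = 0 := by
    filter_upwards [hmem] with z hz h0 v hv
    rw [metricInChart_apply, fieldInChart, ofComps_comps (pointAt_mem_source hz.1)]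
    have h0' := (L.mem_singSet g _).2 h0
    refine hN.normal _ ⟨h0', hz.2⟩ _ ((hL.mem_tangentTo_singSet hS g h0' _).2 ?_)
    rw [← hL.mu_comp_ofComps g hz.1] at hv
    exact hv
  -- The Schouten term carries the factor `σ_L`, which vanishes at `p`.
  have hr : localHessian (metricInChart g.1.inner p) (L.sigmaInChart g p) y =
      -L.rho g p • metricInChart g.1.inner p y := by
    ext u v
    have h := hL.localHessian_eq g p (ofComps p p u) (ofComps p p v)
    rw [(L.mem_singSet g p).1 hp, ← metricInChart_self] at h
    simp only [comps_ofComps hsrc] at h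
    rw [h, smul_apply, smul_apply, smul_eq_mul]
    ring
  have hunitnormal := hlm.unit_normal hs0 (K.metricInChart_scaleMetric g p y) hS'
    (hgrad.self_of_nhds ht0) (hunit.self_of_nhds ht0) (hnormal.self_of_nhds ht0)
  rw [sigmaInChart_self, fieldInChart_self, ← hL.mu_apply] at hunitnormal
  have hinner : K.sigma g p * L.rho g p + coInner g.1.inner p (K.mu g p) (L.mu g p) =
      inner K L p := by
    rw [inner_eq K L g, innerIn, (L.mem_singSet g p).1 hp]
    ring
  have hw {x : Coord d} (hx : fderiv ℝ (L.sigmaInChart g p) y x = 0) :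
      fderiv ℝ (fieldInChart N p) y x +
        localChristoffel (metricInChart K.scaleMetric p) y x (comps p p (N p)) =
      -((K.sigma g p)⁻¹ * L.mu g p (N p) / -L.S p * inner K L p) • x := by
    have h := hlm.weingarten_zero_set (K.sigmaInChart_contDiffAt_two g p)
      (L.sigmaInChart_contDiffAt_two g p) hs0 ht0
      (K.metricInChart_scaleMetric_eventuallyEq g p y) (hNs.of_le ENat.LEInfty.out) hS'
      hgrad hunit hnormal hr hx
    rwa [sigmaInChart_self, fieldInChart_self, ← hL.mu_apply, ← hK.coInner_mu_self hL,
      hinner] at h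
  -- By `hunitnormal`, `a` is one of the two numbers `±1 / √(-S_L)`; its sign records the side to
  -- which `N` points.
  set a : ℝ := (K.sigma g p)⁻¹ * L.mu g p (N p) / -L.S p with ha
  have haN : L.mu g p (N p) = a * -L.S p * K.sigma g p := by
    have := (hS p).ne
    rw [ha]
    field_simp
  have hmu (X : TangentSpace (𝓡 d) p) :
      K.scaleMetric p (N p) X = a * (K.sigma g p)⁻¹ * L.mu g p X := by
    have := DFunLike.congr_fun hunitnormal.1 (comps p p X)
    rwa [metricInChart_comps, smul_apply, smul_eq_mul, ← hL.mu_apply] at this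
  have hcov (X : TangentSpace (𝓡 d) p) (hX : L.mu g p X = 0) :
      covDeriv K.scaleMetric N p X = -(a * inner K L p) • X := by
    rw [hL.mu_apply] at hX
    have h := congrArg (ofComps p p) (hw hX)
    rw [map_smul, ofComps_comps hsrc] at h
    rw [← h, ← fieldInChart_self]
    rfl
  refine ⟨a, hunitnormal.2, ?_, fun X hX => hcov X ?_, ?_⟩
  · rw [mvfderiv_ratio hL g hp (hU hpU), haN]
    field_simp
  · exact (hL.mem_tangentTo_singSet hS g hp X).1 hX
  · have hproj (X : TangentSpace (𝓡 d) p) :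
        L.mu g p (normalProj K.scaleMetric N p X) = 0 := by
      simp only [normalProj, sub_apply, ContinuousLinearMap.smulRight_apply,
        ContinuousLinearMap.id_apply, map_sub, map_smul, smul_eq_mul, hmu, haN]
      have := hunitnormal.2
      field_simp
      linear_combination (-L.mu g p X) * this
    -- The projection takes values in the tangent space, where the Weingarten map is scalar.
    have e : ((covDeriv K.scaleMetric N p).comp (normalProj K.scaleMetric N p)).toLinearMap =
        -(a * inner K L p) • (normalProj K.scaleMetric N p).toLinearMap :=
      LinearMap.ext fun X => hcov _ (hproj X)
    -- The identity has trace `d`, and the rank-one part has trace `G(N, N) = 1`.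
    have htr : LinearMap.trace ℝ (TangentSpace (𝓡 d) p)
        (normalProj K.scaleMetric N p).toLinearMap = (d : ℝ) - 1 := by
      have : Module.Finite ℝ (TangentSpace (𝓡 d) p) :=
        inferInstanceAs (Module.Finite ℝ (Coord d))
      have e₁ : (normalProj K.scaleMetric N p).toLinearMap = LinearMap.id -
          (K.scaleMetric p (N p)).toLinearMap.smulRight (N p) := rfl
      have e₂ : LinearMap.trace ℝ (TangentSpace (𝓡 d) p) LinearMap.id = d := by
        rw [LinearMap.trace_id]
        exact_mod_cast finrank_euclideanSpace_fin (𝕜 := ℝ) (n := d)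
      have e₃ := LinearMap.trace_smulRight (K.scaleMetric p (N p)).toLinearMap (N p)
      rw [e₁, map_sub, e₂, e₃]
      congr 1
      exact hN.unit p ⟨hp, hpU⟩
    have hd' : (d : ℝ) - 1 ≠ 0 := by
      have : (3 : ℝ) ≤ d := by exact_mod_cast hd
      linarith
    rw [meanCurvature, e, map_smul, htr, smul_eq_mul, mul_div_cancel_right₀ _ hd']

/-- The normalised gradient of `σ_L / σ_K` is a unit normal of the zero set of `σ_L`. -/
theorem IsParallel.exists_isUnitNormal [PreconnectedSpace M] (hL : L.IsParallel)
    (hS : ∀ p, L.S p < 0) (K : Tractor c) :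
    ∃ N : ∀ q : M, TangentSpace (𝓡 d) q,
      IsUnitNormal K.scaleMetric L.singSet K.singSetᶜ N ∧
        ∀ p ∈ L.singSet ∩ K.singSetᶜ, 0 < mvfderiv (𝓡 d) (ratio L K) p (N p) := by
  let g := someScale c
  have hS' (p : M) : 0 < -L.S p := by linarith [hS p]
  -- On the zero set of `σ_L`, off that of `σ_K`, the gradient of `σ_L / σ_K` for `σ_K⁻² g` is `σ_K²
  -- · σ_K⁻¹ μ_L^♯ = σ_K μ_L^♯`, of length `|μ_L| = √(-S_L)`. The formula also gives an extension
  -- off the zero set.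
  let N : ∀ q : M, TangentSpace (𝓡 d) q := fun q =>
    ((√(-L.S q))⁻¹ * K.sigma g q) • sharp g.1.inner q (L.mu g q)
  have hG (q : M) (hq : q ∈ K.singSetᶜ) (X : TangentSpace (𝓡 d) q) :
      K.scaleMetric q (N q) X = (√(-L.S q))⁻¹ * (K.sigma g q)⁻¹ * L.mu g q X := by
    have h0 := sigma_ne_zero hq g
    simp only [K.scaleMetric_eq g, N, map_smul, smul_apply, smul_eq_mul, g.1.inner_sharp]
    field_simp
  have hmu (q : M) (hq : q ∈ L.singSet) : L.mu g q (N q) = √(-L.S q) * K.sigma g q := by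
    have h : L.mu g q (sharp g.1.inner q (L.mu g q)) = √(-L.S q) * √(-L.S q) := by
      rw [Real.mul_self_sqrt (hS' q).le]
      exact coInner_mu_of_mem_singSet g hq
    have h0 := Real.sqrt_pos.2 (hS' q)
    simp only [N, map_smul, smul_eq_mul, h]
    field_simp
  refine ⟨N, ⟨K.isOpen_compl_singSet, ?_, ?_, ?_⟩, ?_⟩
  · intro p _
    refine ContMDiffAt.contMDiffWithinAt ((contMDiffAt_field_iff (mem_chart_source _ p)).2
      (contMDiffAt_of_comp_pointAt ?_))
    have hy := mem_extChartAt_target (I := 𝓡 d) p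
    -- As `S_L` is constant, the square root may be frozen at `p`, so only `σ_K` and the gradient of
    -- `σ_L` have to be smooth.
    have h := ((contDiffAt_const (c := (√(-L.S p))⁻¹)).mul (K.contDiffAt_sigmaInChart g hy)).smul
      ((contDiffAt_inverse_of_pos (g.1.contDiffAt_metricInChart hy)
        (g.1.metricInChart_pos hy)).clm_apply (L.fderiv_sigmaInChart_contDiffAt g hy))
    refine h.congr_of_eventuallyEq ?_
    filter_upwards [eventually_mem_target hy] with z hz
    simp only [N, map_smul]
    change _ = ((√(-L.S p))⁻¹ * K.sigmaInChart g p z) •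
      (metricInChart g.1.inner p z).inverse (fderiv ℝ (L.sigmaInChart g p) z)
    rw [← hL.mu_comp_ofComps g hz, g.1.inverse_metricInChart hz, S, hL.inner_const hL _ p]
    rfl
  · rintro q ⟨hq, hqK⟩
    have h0 := Real.sqrt_pos.2 (hS' q)
    have h1 := sigma_ne_zero hqK g
    rw [hG q hqK, hmu q hq]
    field_simp
  · rintro q ⟨hq, hqK⟩ X hX
    rw [hG q hqK, (hL.mem_tangentTo_singSet hS g hq X).1 hX, mul_zero]
  · rintro p ⟨hp, hpK⟩
    have h1 := sigma_ne_zero hpK g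
    rw [mvfderiv_ratio hL g hp hpK, hmu p hp, mul_div_cancel_right₀ _ h1]
    exact Real.sqrt_pos.2 (hS' p)

end Hypersurface

end Tractor

end ScaleMetric

end ConfGeom

/-! ### The main theorem -/

theorem theorem1p3 (d : ℕ) (hd : 3 ≤ d)
    {M : Type*} [TopologicalSpace M] [T2Space M] [SecondCountableTopology M] [ConnectedSpace M]
    [ChartedSpace (Coord d) M] [IsManifold (𝓡 d) ∞ M]
    (c : ConformalStructure d M) (K₁ K₂ : Tractor c)
    (hK₁ : K₁.IsParallel) (hK₂ : K₂.IsParallel)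
    (hind : LinearIndependent ℝ ![K₁, K₂])
    (hS : ∀ p, K₂.S p < 0) (hne : K₂.singSet.Nonempty) :
    -- `h(K₁, K₂)`, `S_{K₁}` and `S_{K₂}` are constant
    ∃ k S₁ S₂ : ℝ, (∀ p, Tractor.inner K₁ K₂ p = k) ∧ (∀ p, K₁.S p = S₁) ∧ (∀ p, K₂.S p = S₂) ∧
      -- the metric determined by `K₁` is Einstein on the complement of `Σ_{K₁}`
      IsOpen K₁.singSetᶜ ∧ IsMetricOn K₁.scaleMetric K₁.singSetᶜ ∧
      (∀ p ∈ K₁.singSetᶜ, ∀ X Y : TangentSpace (𝓡 d) p,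
        ricci K₁.scaleMetric p X Y = ((d : ℝ) - 1) * S₁ * K₁.scaleMetric p X Y) ∧
      -- `Σ_{K₂}` is a totally umbilic hypersurface
      IsHypersurface d K₂.singSet ∧
      IsTotallyUmbilic K₁.scaleMetric K₂.singSet K₁.singSetᶜ ∧
      -- it has a unit normal field in the direction of increasing `σ₂ / σ₁`
      (∃ (U : Set M) (N : ∀ q : M, TangentSpace (𝓡 d) q),
        K₂.singSet ∩ K₁.singSetᶜ ⊆ U ∧ U ⊆ K₁.singSetᶜ ∧
        IsUnitNormal K₁.scaleMetric K₂.singSet U N ∧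
        ∀ p ∈ K₂.singSet ∩ U, 0 < mvfderiv (𝓡 d) (Tractor.ratio K₂ K₁) p (N p)) ∧
      -- with respect to such normals the mean curvature is `-h(K₁, K₂) / √(-S_{K₂})`
      (∀ (U : Set M) (N : ∀ q : M, TangentSpace (𝓡 d) q), U ⊆ K₁.singSetᶜ →
        IsUnitNormal K₁.scaleMetric K₂.singSet U N →
        ∀ p ∈ K₂.singSet ∩ U, 0 < mvfderiv (𝓡 d) (Tractor.ratio K₂ K₁) p (N p) →
          meanCurvature K₁.scaleMetric N p = -k / √(-S₂)) ∧
      -- the orthogonal case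
      ((∀ p, Tractor.inner K₁ K₂ p = 0) →
        IsMinimal K₁.scaleMetric K₂.singSet K₁.singSetᶜ ∧
        IsTotallyGeodesic K₁.scaleMetric K₂.singSet K₁.singSetᶜ) := by
  have hcurv {U : Set M} {N : ∀ q : M, TangentSpace (𝓡 d) q} (hU : U ⊆ K₁.singSetᶜ)
      (hN : IsUnitNormal K₁.scaleMetric K₂.singSet U N) {p : M} (hp : p ∈ K₂.singSet ∩ U) :=
    hK₁.weingarten hd hK₂ hS hU hN hp.1 hp.2
  have humb : IsTotallyUmbilic K₁.scaleMetric K₂.singSet K₁.singSetᶜ := by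
    intro U N hU hN p hp X hX Y _
    obtain ⟨a, -, -, h, hH⟩ := hcurv hU hN hp
    rw [secondForm, h X hX, hH, map_smul, smul_apply, smul_eq_mul]
  obtain ⟨o, -⟩ := hne
  have hS₁ (p : M) : K₁.S p = K₁.S o := congrArg Neg.neg (hK₁.inner_const hK₁ p o)
  have hS₂ (p : M) : K₂.S p = K₂.S o := congrArg Neg.neg (hK₂.inner_const hK₂ p o)
  have hk (p : M) := hK₁.inner_const hK₂ p o
  refine ⟨Tractor.inner K₁ K₂ o, K₁.S o, K₂.S o, hk, hS₁, hS₂, K₁.isOpen_compl_singSet,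
    K₁.isMetricOn_scaleMetric, fun p hp X Y => ?_, hK₂.isHypersurface_singSet hS, humb, ?_, ?_, ?_⟩
  · rw [hK₁.ricci_scaleMetric hd hp, hS₁ p]
  · obtain ⟨N, hN, hpos⟩ := hK₂.exists_isUnitNormal hS K₁
    exact ⟨K₁.singSetᶜ, N, inter_subset_right, subset_rfl, hN, hpos⟩
  · intro U N hU hN p hp hpos
    obtain ⟨a, ha, hr, -, hH⟩ := hcurv hU hN hp
    have hS' : 0 < -K₂.S o := by linarith [hS o]
    rw [hr, hS₂ p] at hpos
    rw [hS₂ p] at ha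
    -- The derivative of `σ₂ / σ₁` along `N` is `a` times `-S_{K₂}`, so the orientation forces `a >
    -- 0` and selects the positive root of `a² (-S_{K₂}) = 1`.
    have ha' : a * √(-K₂.S o) = 1 := by
      have h₁ : 0 < a := pos_of_mul_pos_left hpos hS'.le
      refine (pow_eq_one_iff_of_nonneg (mul_nonneg h₁.le (Real.sqrt_nonneg _)) two_ne_zero).1 ?_
      rw [mul_pow, Real.sq_sqrt hS'.le, ha]
    have h₂ := Real.sqrt_pos.2 hS'
    rw [hH, hk p, eq_div_iff h₂.ne']
    linear_combination -(Tractor.inner K₁ K₂ o) * ha'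
  · intro h0
    have hmin : IsMinimal K₁.scaleMetric K₂.singSet K₁.singSetᶜ := by
      intro U N hU hN p hp
      obtain ⟨a, -, -, -, hH⟩ := hcurv hU hN hp
      rw [hH, h0, mul_zero, neg_zero]
    -- By umbilicity the second fundamental form is `H` times the metric, and `H = 0`.
    refine ⟨hmin, fun U N hU hN p hp X hX Y hY => ?_⟩
    rw [humb U N hU hN p hp X hX Y hY, hmin U N hU hN p hp, zero_mul]
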